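/- Let $m,n\ge 2$ be integers, let $\Omega\subset\mathbb R^n$ be a bounded domain with Lipschitz boundary, and let $L\in\mathbb R^{m\times n}$. For $\xi\in\mathbb R^{m\times n}$ write $L\cdot\xi=\sum_{i,j}L_{ij}\xi_{ij}$, and let $|\xi|=(\sum_{i,j}\xi_{ij}^2)^{1/2}$, with $\mathrm{dist}$ the corresponding distance. Let $\eta\in\mathbb R^{m\times n}$ with $|\eta|<1$, $\gamma\in\mathbb R^m$, $a\in\mathbb R^m$, $b\in\mathbb R^n$ be such that $a\ne0$, $Lb\neq 0$ and $L\cdot(a\otimes b)=0$, where $a\otimes b=(a_ib_j)_{i,j}$, and set $t=L\cdot\eta$ and $v_{\eta,\gamma}(x)=\eta x+\gamma$ for $x\in\Omega$. Then there are exactly two numbers $s\in\mathbb R$ with $|\eta+s\,a\otimes b|=1$, and they satisfy $s^-<0<s^+$. Put $\eta^\pm=\eta+s^\pm a\otimes b$. For every $\epsilon>0$ there are infinitely many maps $u\in W^{1,\infty}(\Omega;\mathbb R^m)$ (counted modulo equality a.e. in $\Omega$) such that $$|\nabla u|=1,\qquad L\cdot\nabla u=t,\qquad \mathrm{dist}(\nabla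 u,\{\eta^+,\eta^-\})<\epsilon\qquad\text{a.e. in }\Omega,$$ $$u=v_{\eta,\gamma}\ \text{ on }\partial\Omega,\qquad \|u-v_{\eta,\gamma}\|_{L^\infty(\Omega)}<\epsilon,$$ where $\nabla u$ is the weak gradient and the boundary condition means $u-v_{\eta,\gamma}\in W_0^{1,\infty}(\Omega;\mathbb R^m)=W^{1,\infty}(\Omega;\mathbb R^m)\cap W_0^{1,1}(\Omega;\mathbb R^m)$. -/

import Mathlib

open MeasureTheory Filter Topology
open scoped ContDiff Matrix ENNReal NNReal

/- Matrices carry the Hilbert-Schmidt (Frobenius) norm and the induced distance. -/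
attribute [local instance] Matrix.frobeniusNormedAddCommGroup

noncomputable section

namespace Eikonal

/-- The Euclidean space of dimension `n`. -/
abbrev E (n : ℕ) : Type := EuclideanSpace ℝ (Fin n)

/-- `Ω` has Lipschitz boundary: near each boundary point, `Ω` is the region lying strictly above
the graph of a Lipschitz function, in a suitable orthonormal frame. Here `ν` is the unit vector
along the last axis of the frame and `y - ⟪ν, y⟫ ν` is the projection of `y` onto the hyperplane
orthogonal to `ν`. Only the values of `ψ` on that hyperplane matter. -/
def HasLipschitzBoundary {n : ℕ} (Ω : Set (E n)) : Prop :=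
  ∀ x ∈ frontier Ω, ∃ (ν : E n) (K : ℝ≥0) (ψ : E n → ℝ) (r : ℝ),
    ‖ν‖ = 1 ∧ LipschitzWith K ψ ∧ 0 < r ∧
      ∀ y ∈ Metric.ball x r, y ∈ Ω ↔ ψ (y - (inner ℝ ν y) • ν) < inner ℝ ν y

/-- A bounded domain (nonempty connected open set) with Lipschitz boundary. -/
structure IsBoundedLipschitzDomain {n : ℕ} (Ω : Set (E n)) : Prop where
  isOpen : IsOpen Ω
  isConnected : IsConnected Ω
  isBounded : Bornology.IsBounded Ω
  lipschitzBoundary : HasLipschitzBoundary Ω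

/-- `φ` belongs to `C_c^∞(Ω; F)` (a smooth function on the whole space whose support is a compact
subset of `Ω`). -/
def IsTestFunction {n : ℕ} {F : Type*} [NormedAddCommGroup F] [NormedSpace ℝ F]
    (Ω : Set (E n)) (φ : E n → F) : Prop :=
  ContDiff ℝ ∞ φ ∧ HasCompactSupport φ ∧ tsupport φ ⊆ Ω

/-- The classical partial derivative in the direction of the `j`-th coordinate. -/
def partialDeriv {n : ℕ} {F : Type*} [NormedAddCommGroup F] [NormedSpace ℝ F]
    (j : Fin n) (φ : E n → F) (x : E n) : F :=
  fderiv ℝ φ x (EuclideanSpace.single j 1)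

/-- The matrix field `G` is the weak gradient of `u` in `Ω`: for all `i`, `j`, the function
`G i j` is the weak partial derivative `∂u^i/∂x_j` in `Ω`. -/
def HasWeakGradient {m n : ℕ} (Ω : Set (E n)) (u : E n → E m)
    (G : E n → Matrix (Fin m) (Fin n) ℝ) : Prop :=
  ∀ (i : Fin m) (j : Fin n),
    LocallyIntegrableOn (fun x => u x i) Ω ∧ LocallyIntegrableOn (fun x => G x i j) Ω ∧
      ∀ φ : E n → ℝ, IsTestFunction Ω φ →
        ∫ x in Ω, u x i * partialDeriv j φ x = - ∫ x in Ω, G x i j * φ x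

/-- `u` belongs to the Sobolev space `W^{1,p}(Ω; ℝ^m)`. -/
def MemW1 {m n : ℕ} (p : ℝ≥0∞) (Ω : Set (E n)) (u : E n → E m) : Prop :=
  MemLp u p (volume.restrict Ω) ∧
    ∃ G : E n → Matrix (Fin m) (Fin n) ℝ, HasWeakGradient Ω u G ∧
      ∀ i j, MemLp (fun x => G x i j) p (volume.restrict Ω)

/-- `u` belongs to `W_0^{1,1}(Ω; ℝ^m)`, the closure of `C_c^∞(Ω; ℝ^m)` in `W^{1,1}(Ω; ℝ^m)`. -/
def MemW1Zero {m n : ℕ} (Ω : Set (E n)) (u : E n → E m) : Prop :=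
  MemW1 1 Ω u ∧
    ∃ G : E n → Matrix (Fin m) (Fin n) ℝ, HasWeakGradient Ω u G ∧
      ∃ φ : ℕ → E n → E m, (∀ k, IsTestFunction Ω (φ k)) ∧
        Tendsto (fun k => eLpNorm (fun x => φ k x - u x) 1 (volume.restrict Ω)) atTop (𝓝 0) ∧
        ∀ i j, Tendsto (fun k => eLpNorm (fun x => partialDeriv j (φ k) x i - G x i j) 1
          (volume.restrict Ω)) atTop (𝓝 0)

/-- `u` belongs to `W_0^{1,∞}(Ω; ℝ^m) = W^{1,∞}(Ω; ℝ^m) ∩ W_0^{1,1}(Ω; ℝ^m)`. -/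
def MemW1InftyZero {m n : ℕ} (Ω : Set (E n)) (u : E n → E m) : Prop :=
  MemW1 ∞ Ω u ∧ MemW1Zero Ω u

/-- The linear function `𝓛(ξ) = L · ξ = ∑ i j, L i j * ξ i j` on matrices. -/
def matDot {m n : ℕ} (L ξ : Matrix (Fin m) (Fin n) ℝ) : ℝ :=
  ∑ i, ∑ j, L i j * ξ i j

/-- The affine map `v_{η,γ}(x) = η x + γ`. -/
def affineMap {m n : ℕ} (η : Matrix (Fin m) (Fin n) ℝ) (γ : E m) (x : E n) : E m :=
  WithLp.toLp 2 (η *ᵥ WithLp.ofLp x) + γ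

/-- `u` solves the Dirichlet problem for the linearly constrained eikonal equation:
`u ∈ W^{1,∞}(Ω; ℝ^m)`, and a.e. in `Ω` one has `|∇u| = 1`, `L · ∇u = t` and
`dist(∇u, {ηp, ηm}) < ε`; moreover `u = v_{η,γ}` on the boundary in the sense
`u ∈ v_{η,γ} + W_0^{1,∞}(Ω; ℝ^m)`, and `‖u - v_{η,γ}‖_{L^∞(Ω)} < ε`. -/
structure IsSolution {m n : ℕ} (Ω : Set (E n)) (L : Matrix (Fin m) (Fin n) ℝ) (t : ℝ)
    (η : Matrix (Fin m) (Fin n) ℝ) (γ : E m) (ηp ηm : Matrix (Fin m) (Fin n) ℝ) (ε : ℝ)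
    (u : E n → E m) : Prop where
  memW1 : MemW1 ∞ Ω u
  gradient : ∃ G : E n → Matrix (Fin m) (Fin n) ℝ, HasWeakGradient Ω u G ∧
    ∀ᵐ x ∂(volume.restrict Ω),
      ‖G x‖ = 1 ∧ matDot L (G x) = t ∧ Metric.infDist (G x) {ηp, ηm} < ε
  boundary : MemW1InftyZero Ω (fun x => u x - affineMap η γ x)
  close : eLpNorm (fun x => u x - affineMap η γ x) ∞ (volume.restrict Ω) < ENNReal.ofReal ε

end Eikonal

end

/-! The proof is convex integration by small oscillations. Write `A = a ⊗ b`. A plane wave in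
direction `b` with values along `a` has gradient parallel to `A`, and `L · A = 0`, but cutting it
off to compact support destroys the linear constraint. The repair is a scalar potential: with `c =
Lb`, `v = Lᵀc`, `w = Lᵀa`, the map `(∂_v Ψ) a - (∂_w Ψ) c` satisfies the constraint exactly, since
`L` applied to its gradient is `D²Ψ(w,v) - D²Ψ(v,w) = 0`. For `Ψ` a cut-off cosine of large
frequency in direction `b`, the gradient is `cos(…) h A` up to a small error, because `⟨b,v⟩ = |Lb|²
> 0` and `⟨b,w⟩ = L · A = 0` (`exists_oscillation`).

Let `F = η + ∇w` have modulus less than `1`, with `w` a test function. Choosing `h` proportional to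
the defect `1 - |F|²` keeps the new modulus below `1`, and the square of the defect is controlled by
the `L²` norm of the added gradient (`exists_perturbation`). Iterate with rapidly decreasing
sup-norm tolerances. Integration by parts makes each added gradient almost orthogonal in `L²` to all
earlier ones; since the gradients are bounded, they converge strongly in `L²`
(`cauchySeq_of_almost_orthogonal`). The increments then tend to zero, hence so does the defect, and
the limit gradient has modulus `1` (`exists_limit`).

The components of the increments orthogonal to `A` have a small sum, so the limit gradient stays
near the line `η + ℝA`; being on the unit sphere, it is near `η⁺` or `η⁻` by compactness
(`exists_infDist_lt`). Infinitely many solutions follow because no solution is `v_{η,γ}` itself,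
while solutions exist arbitrarily close to it. -/

namespace Eikonal

/-- Matrices, seen as vectors of a Euclidean space. -/
abbrev GradSpace (m n : ℕ) : Type := EuclideanSpace ℝ (Fin m × Fin n)

/-- The vector of entries of a matrix. -/
def flatten {m n : ℕ} (M : Matrix (Fin m) (Fin n) ℝ) : GradSpace m n :=
  WithLp.toLp 2 fun p => M p.1 p.2

/-- The classical gradient, as a vector field with values in a Euclidean space. -/
noncomputable def grad {m n : ℕ} (w : E n → E m) (x : E n) : GradSpace m n :=
  WithLp.toLp 2 fun p => partialDeriv p.2 w x p.1

/-! ### Matrices as vectors of an inner product space -/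

section Flatten

variable {m n : ℕ}

@[simp] lemma flatten_apply (M : Matrix (Fin m) (Fin n) ℝ) (p : Fin m × Fin n) :
    flatten M p = M p.1 p.2 := rfl

@[simp] lemma grad_apply (w : E n → E m) (x : E n) (p : Fin m × Fin n) :
    grad w x p = partialDeriv p.2 w x p.1 := rfl

lemma flatten_add (M N : Matrix (Fin m) (Fin n) ℝ) :
    flatten (M + N) = flatten M + flatten N := rfl

lemma flatten_smul (c : ℝ) (M : Matrix (Fin m) (Fin n) ℝ) :
    flatten (c • M) = c • flatten M := rfl

lemma norm_flatten (M : Matrix (Fin m) (Fin n) ℝ) : ‖flatten M‖ = ‖M‖ := by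
  rw [Matrix.frobenius_norm_def, EuclideanSpace.norm_eq, Real.sqrt_eq_rpow, Fintype.sum_prod_type]
  simp [flatten]

lemma dist_flatten (M N : Matrix (Fin m) (Fin n) ℝ) : dist (flatten M) (flatten N) = dist M N := by
  rw [dist_eq_norm, dist_eq_norm, ← norm_flatten]
  rfl

lemma inner_flatten (L : Matrix (Fin m) (Fin n) ℝ) (v : GradSpace m n) :
    inner ℝ (flatten L) v = ∑ i, ∑ j, L i j * v (i, j) := by
  rw [PiLp.inner_apply, Fintype.sum_prod_type]
  simp [mul_comm]

lemma matDot_eq_inner (L M : Matrix (Fin m) (Fin n) ℝ) :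
    matDot L M = inner ℝ (flatten L) (flatten M) := by
  rw [inner_flatten]
  rfl

lemma norm_le_sum_abs {ι : Type*} [Fintype ι] (v : EuclideanSpace ℝ ι) : ‖v‖ ≤ ∑ i, |v i| := by
  rw [EuclideanSpace.norm_eq]
  refine Real.sqrt_le_iff.2 ⟨Finset.sum_nonneg fun i _ => abs_nonneg _, ?_⟩
  exact Finset.sum_sq_le_sq_sum_of_nonneg fun i _ => abs_nonneg _

lemma sum_smul_single (v : E n) : ∑ j, v j • EuclideanSpace.single j (1 : ℝ) = v := by
  ext k
  simp [Finset.sum_apply, Pi.single_apply]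

end Flatten

/-! ### Test functions, gradients and integration by parts -/

section TestFunction

variable {n : ℕ} {F : Type*} [NormedAddCommGroup F] [NormedSpace ℝ F] {Ω : Set (E n)}

lemma IsTestFunction.add {φ ψ : E n → F} (hφ : IsTestFunction Ω φ) (hψ : IsTestFunction Ω ψ) :
    IsTestFunction Ω (fun x => φ x + ψ x) :=
  ⟨hφ.1.add hψ.1, hφ.2.1.add hψ.2.1,
    (tsupport_add φ ψ).trans (Set.union_subset hφ.2.2 hψ.2.2)⟩

lemma IsTestFunction.zero : IsTestFunction Ω (fun _ => (0 : F)) :=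
  ⟨contDiff_const, HasCompactSupport.zero, by simp [tsupport]⟩

lemma IsTestFunction.clm_comp {F' : Type*} [NormedAddCommGroup F'] [NormedSpace ℝ F']
    {φ : E n → F} (hφ : IsTestFunction Ω φ) (T : F →L[ℝ] F') :
    IsTestFunction Ω (fun x => T (φ x)) :=
  ⟨T.contDiff.comp hφ.1, hφ.2.1.comp_left (g := T) (map_zero T),
    (tsupport_comp_subset (g := T) (map_zero T) φ).trans hφ.2.2⟩

lemma IsTestFunction.fderiv {φ : E n → F} (hφ : IsTestFunction Ω φ) :
    IsTestFunction Ω (fderiv ℝ φ) :=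
  ⟨hφ.1.fderiv_right (by simp), hφ.2.1.fderiv ℝ, (tsupport_fderiv_subset ℝ).trans hφ.2.2⟩

lemma IsTestFunction.partialDeriv {φ : E n → F} (hφ : IsTestFunction Ω φ) (j : Fin n) :
    IsTestFunction Ω (partialDeriv j φ) :=
  hφ.fderiv.clm_comp (ContinuousLinearMap.apply ℝ F (EuclideanSpace.single j (1 : ℝ)))

lemma IsTestFunction.eq_zero {φ : E n → F} (hφ : IsTestFunction Ω φ) {x : E n} (hx : x ∉ Ω) :
    φ x = 0 :=
  image_eq_zero_of_notMem_tsupport fun h => hx (hφ.2.2 h)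

lemma IsTestFunction.setIntegral_eq {φ : E n → F} (hφ : IsTestFunction Ω φ)
    (f : E n → ℝ) : ∫ x in Ω, f x • φ x = ∫ x, f x • φ x :=
  setIntegral_eq_integral_of_forall_compl_eq_zero fun x hx => by simp [hφ.eq_zero hx]

lemma IsTestFunction.exists_bound {φ : E n → F} (hφ : IsTestFunction Ω φ) :
    ∃ C, 0 ≤ C ∧ ∀ x, ‖φ x‖ ≤ C := by
  obtain ⟨C, hC⟩ := hφ.2.1.exists_bound_of_continuous hφ.1.continuous
  exact ⟨C, (norm_nonneg _).trans (hC 0), hC⟩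

lemma IsTestFunction.memLp {φ : E n → F} (hφ : IsTestFunction Ω φ) (p : ℝ≥0∞) :
    MemLp φ p (volume.restrict Ω) :=
  (hφ.1.continuous.memLp_of_hasCompactSupport hφ.2.1).restrict _

variable {m : ℕ}

lemma IsTestFunction.comp {w : E n → E m} (hw : IsTestFunction Ω w) (i : Fin m) :
    IsTestFunction Ω (fun x => w x i) :=
  hw.clm_comp (EuclideanSpace.proj i)

lemma partialDeriv_comp {w : E n → E m} {x : E n} (hw : DifferentiableAt ℝ w x) (i : Fin m)
    (j : Fin n) : partialDeriv j (fun y => w y i) x = partialDeriv j w x i := by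
  have h := ((EuclideanSpace.proj (𝕜 := ℝ) i).hasFDerivAt.comp x hw.hasFDerivAt).fderiv
  unfold partialDeriv
  erw [h]
  rfl

lemma IsTestFunction.differentiable {φ : E n → F} (hφ : IsTestFunction Ω φ) :
    Differentiable ℝ φ := hφ.1.differentiable (by simp)

/-- The linear map sending a Fréchet derivative to the vector of partial derivatives. -/
noncomputable def gradOfDeriv (m n : ℕ) : (E n →L[ℝ] E m) →L[ℝ] GradSpace m n :=
  LinearMap.toContinuousLinearMap
    { toFun := fun T => WithLp.toLp 2 fun p => T (EuclideanSpace.single p.2 1) p.1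
      map_add' := fun _ _ => rfl
      map_smul' := fun _ _ => rfl }

lemma grad_eq (w : E n → E m) (x : E n) : grad w x = gradOfDeriv m n (_root_.fderiv ℝ w x) := rfl

lemma IsTestFunction.grad {w : E n → E m} (hw : IsTestFunction Ω w) :
    IsTestFunction Ω (grad w) :=
  hw.fderiv.clm_comp (gradOfDeriv m n)

lemma grad_add {w z : E n → E m} (hw : Differentiable ℝ w) (hz : Differentiable ℝ z) (x : E n) :
    Eikonal.grad (fun x => w x + z x) x = Eikonal.grad w x + Eikonal.grad z x := by
  rw [grad_eq, grad_eq, grad_eq, ← map_add]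
  congr 1
  exact fderiv_add (hw x) (hz x)

lemma integral_mul_partialDeriv {Ω : Set (E n)} {f φ : E n → ℝ} (hf : ContDiff ℝ ∞ f)
    (hφ : IsTestFunction Ω φ) (j : Fin n) :
    ∫ x in Ω, f x * Eikonal.partialDeriv j φ x = - ∫ x in Ω, Eikonal.partialDeriv j f x * φ x := by
  have h1 := (hφ.partialDeriv j).setIntegral_eq f
  have h2 := hφ.setIntegral_eq (fun x => Eikonal.partialDeriv j f x)
  simp only [smul_eq_mul] at h1 h2
  rw [h1, h2]
  have hf' : Continuous fun x => Eikonal.partialDeriv j f x :=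
    (hf.continuous_fderiv (by simp)).clm_apply continuous_const
  have hφ' := hφ.partialDeriv j
  refine integral_mul_fderiv_eq_neg_fderiv_mul_of_integrable ?_ ?_ ?_
    (fun x _ => hf.differentiable (by simp) x) (fun x _ => hφ.differentiable x)
  · exact (hf'.mul hφ.1.continuous).integrable_of_hasCompactSupport hφ.2.1.mul_left
  · exact (hf.continuous.mul hφ'.1.continuous).integrable_of_hasCompactSupport hφ'.2.1.mul_left
  · exact (hf.continuous.mul hφ.1.continuous).integrable_of_hasCompactSupport hφ.2.1.mul_left

/-- Gradients of uniformly small test functions are almost orthogonal to a given gradient. -/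
lemma exists_abs_integral_inner_grad_le {w : E n → E m} (hw : IsTestFunction Ω w) :
    ∃ C, 0 ≤ C ∧ ∀ φ : E n → E m, IsTestFunction Ω φ → ∀ δ : ℝ, (∀ x, ‖φ x‖ ≤ δ) →
      |∫ x in Ω, inner ℝ (Eikonal.grad w x) (Eikonal.grad φ x)| ≤ C * δ := by
  -- One integration by parts moves the derivative from `φ` onto the fixed map `w`, so only the size
  -- of `φ` matters; the constant is the sum of the `L¹` norms of the pure second derivatives of
  -- `w`.
  let D : Fin m × Fin n → E n → ℝ := fun p =>
    Eikonal.partialDeriv p.2 (Eikonal.partialDeriv p.2 (fun x => w x p.1))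
  have hD : ∀ p, IsTestFunction Ω (D p) := fun p => ((hw.comp p.1).partialDeriv p.2).partialDeriv p.2
  refine ⟨∑ p, ∫ x in Ω, |D p x|, Finset.sum_nonneg fun p _ => integral_nonneg fun x => abs_nonneg _,
    fun φ hφ δ hδ => ?_⟩
  have key : ∀ p : Fin m × Fin n, ∫ x in Ω, Eikonal.partialDeriv p.2 w x p.1 *
      Eikonal.partialDeriv p.2 φ x p.1 = - ∫ x in Ω, D p x * φ x p.1 := by
    intro p
    rw [← integral_mul_partialDeriv ((hw.comp p.1).partialDeriv p.2).1 (hφ.comp p.1) p.2]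
    congr 1 with x
    rw [partialDeriv_comp (hw.differentiable x), partialDeriv_comp (hφ.differentiable x)]
  have hint : ∀ p : Fin m × Fin n, Integrable (fun x => Eikonal.partialDeriv p.2 w x p.1 *
      Eikonal.partialDeriv p.2 φ x p.1) (volume.restrict Ω) := by
    intro p
    have h1 := (hw.partialDeriv p.2).comp p.1
    have h2 := (hφ.partialDeriv p.2).comp p.1
    exact ((h1.1.continuous.mul h2.1.continuous).integrable_of_hasCompactSupport
      h2.2.1.mul_left).restrict
  have hexp : ∀ x, inner ℝ (Eikonal.grad w x) (Eikonal.grad φ x) =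
      ∑ p : Fin m × Fin n, Eikonal.partialDeriv p.2 w x p.1 * Eikonal.partialDeriv p.2 φ x p.1 := by
    intro x
    rw [PiLp.inner_apply]
    simp [mul_comm]
  simp_rw [hexp]
  rw [integral_finsetSum _ fun p _ => hint p, Finset.sum_mul]
  refine (Finset.abs_sum_le_sum_abs _ _).trans (Finset.sum_le_sum fun p _ => ?_)
  rw [key p, abs_neg, ← integral_mul_const]
  refine (abs_integral_le_integral_abs).trans ?_
  refine integral_mono_of_nonneg (ae_of_all _ fun x => abs_nonneg _) ?_ (ae_of_all _ fun x => ?_)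
  · exact (memLp_one_iff_integrable.1 ((hD p).memLp 1)).abs.mul_const _
  · simp only [abs_mul]
    exact mul_le_mul_of_nonneg_left ((PiLp.norm_apply_le (φ x) p.1).trans (hδ x)) (abs_nonneg _)

end TestFunction

end Eikonal

namespace Eikonal

/-! ### Oscillating maps that respect the linear constraint -/

section Oscillation

variable {m n : ℕ}

/-- A modulated plane wave `cos(N ⟪β, x⟫ + τ) h(x)`. -/
noncomputable def wave (β : E n) (h : E n → ℝ) (N τ : ℝ) (x : E n) : ℝ :=
  Real.cos (N * inner ℝ β x + τ) * h x

lemma hasFDerivAt_phase (β : E n) (N τ : ℝ) (x : E n) :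
    HasFDerivAt (fun y => N * inner ℝ β y + τ) (N • innerSL ℝ β) x :=
  (((innerSL ℝ β).hasFDerivAt (x := x)).const_mul N).add_const τ

lemma IsTestFunction.wave {h : E n → ℝ} {Ω : Set (E n)} (hh : IsTestFunction Ω h) (β : E n)
    (N τ : ℝ) : IsTestFunction Ω (wave β h N τ) := by
  refine ⟨?_, hh.2.1.mul_left, (tsupport_mul_subset_right).trans hh.2.2⟩
  refine ContDiff.mul (Real.contDiff_cos.comp ?_) hh.1
  exact (contDiff_const.mul (innerSL ℝ β).contDiff).add contDiff_const

lemma fderiv_wave {h : E n → ℝ} (hh : Differentiable ℝ h) (β : E n) (N τ : ℝ) (x v : E n) :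
    fderiv ℝ (wave β h N τ) x v =
      Real.cos (N * inner ℝ β x + τ) * fderiv ℝ h x v
        + -(N * inner ℝ β v) * (Real.sin (N * inner ℝ β x + τ) * h x) := by
  have h1 := ((hasFDerivAt_phase β N τ x).cos).mul (hh x).hasFDerivAt
  have h2 : fderiv ℝ (wave β h N τ) x = _ := h1.fderiv
  rw [h2]
  simp
  ring

lemma fderiv_fderiv_wave {h : E n → ℝ} (hh : ContDiff ℝ ∞ h) (β : E n) (N τ : ℝ)
    (x e v : E n) :
    fderiv ℝ (fderiv ℝ (wave β h N τ)) x e v =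
      -(N ^ 2 * (Real.cos (N * inner ℝ β x + τ) * h x * inner ℝ β e * inner ℝ β v))
      + N * -(Real.sin (N * inner ℝ β x + τ) *
        (inner ℝ β e * fderiv ℝ h x v + inner ℝ β v * fderiv ℝ h x e))
      + Real.cos (N * inner ℝ β x + τ) * fderiv ℝ (fderiv ℝ h) x e v := by
  have hw : ContDiff ℝ ∞ (wave β h N τ) := by
    refine ContDiff.mul (Real.contDiff_cos.comp ?_) hh
    exact (contDiff_const.mul (innerSL ℝ β).contDiff).add contDiff_const
  have hd : Differentiable ℝ h := hh.differentiable (by simp)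
  have hd2 : Differentiable ℝ (fderiv ℝ h) :=
    (hh.fderiv_right (m := ∞) (by simp)).differentiable (by simp)
  have hwd2 : Differentiable ℝ (fderiv ℝ (wave β h N τ)) :=
    (hw.fderiv_right (m := ∞) (by simp)).differentiable (by simp)
  have e1 : fderiv ℝ (fun y => fderiv ℝ (wave β h N τ) y v) x e =
      fderiv ℝ (fderiv ℝ (wave β h N τ)) x e v := by
    have := ((hwd2 x).hasFDerivAt.clm_apply (hasFDerivAt_const v x)).fderiv
    rw [this]; simp
  rw [← e1]
  simp_rw [fderiv_wave hd]
  have h1 : HasFDerivAt (fun y => fderiv ℝ h y v) _ x :=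
    (hd2 x).hasFDerivAt.clm_apply (hasFDerivAt_const v x)
  have h2 := ((hasFDerivAt_phase β N τ x).cos.mul h1).add
    ((((hasFDerivAt_phase β N τ x).sin).mul (hd x).hasFDerivAt).const_mul (-(N * inner ℝ β v)))
  have h3 := h2.fderiv
  erw [h3]
  simp
  ring

/-- First and second derivatives of modulated plane waves of large frequency. -/
lemma exists_wave_bounds {h : E n → ℝ} {Ω : Set (E n)} (hh : IsTestFunction Ω h) (β : E n) :
    ∃ C, 0 ≤ C ∧ ∀ N τ : ℝ, 1 ≤ N → ∀ x e v : E n,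
      |fderiv ℝ (wave β h N τ) x v| ≤ C * N * ‖v‖ ∧
      |fderiv ℝ (fderiv ℝ (wave β h N τ)) x e v +
        N ^ 2 * (Real.cos (N * inner ℝ β x + τ) * h x * inner ℝ β e * inner ℝ β v)| ≤
        C * N * (‖e‖ * ‖v‖) := by
  obtain ⟨C0, h0, hC0⟩ := hh.exists_bound
  obtain ⟨C1, h1, hC1⟩ := hh.fderiv.exists_bound
  obtain ⟨C2, h2, hC2⟩ := hh.fderiv.fderiv.exists_bound
  refine ⟨‖β‖ * C0 + 2 * (‖β‖ * C1) + C1 + C2, by positivity, fun N τ hN x e v => ?_⟩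
  have hN0 : 0 ≤ N := by linarith
  have hβ : ∀ y : E n, |inner ℝ β y| ≤ ‖β‖ * ‖y‖ := fun y => abs_real_inner_le_norm β y
  have hD : ∀ y : E n, |fderiv ℝ h x y| ≤ C1 * ‖y‖ := fun y =>
    ((fderiv ℝ h x).le_opNorm y).trans (by gcongr; exact hC1 x)
  have hDD : |fderiv ℝ (fderiv ℝ h) x e v| ≤ C2 * ‖e‖ * ‖v‖ :=
    ((fderiv ℝ (fderiv ℝ h) x).le_opNorm₂ e v).trans (by gcongr; exact hC2 x)
  have hcos := Real.abs_cos_le_one (N * inner ℝ β x + τ)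
  have hsin := Real.abs_sin_le_one (N * inner ℝ β x + τ)
  have hx : |h x| ≤ C0 := hC0 x
  constructor
  · rw [fderiv_wave hh.differentiable]
    calc _ ≤ 1 * (C1 * ‖v‖) + N * (‖β‖ * ‖v‖) * (1 * C0) := by
          refine (abs_add_le _ _).trans (add_le_add ?_ ?_)
          · rw [abs_mul]
            exact mul_le_mul hcos (hD v) (abs_nonneg _) zero_le_one
          · rw [abs_mul, abs_mul, abs_neg, abs_mul, abs_of_nonneg hN0]
            gcongr
            exact hβ v
      _ ≤ N * (C1 * ‖v‖) + N * (‖β‖ * ‖v‖) * (1 * C0) := by gcongr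
      _ ≤ _ := by
          have : 0 ≤ N * ‖v‖ * (2 * (‖β‖ * C1) + C2) := by positivity
          linarith
  · rw [fderiv_fderiv_wave hh.1]
    have e1 : ∀ X Y Z : ℝ, -(N ^ 2 * X) + N * -Y + Z + N ^ 2 * X = -(N * Y) + Z := by
      intro X Y Z; ring
    rw [e1]
    calc _ ≤ N * (1 * (‖β‖ * ‖e‖ * (C1 * ‖v‖) + ‖β‖ * ‖v‖ * (C1 * ‖e‖)))
            + 1 * (C2 * ‖e‖ * ‖v‖) := by
          refine (abs_add_le _ _).trans (add_le_add ?_ ?_)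
          · rw [abs_neg, abs_mul, abs_mul, abs_of_nonneg hN0]
            gcongr
            refine (abs_add_le _ _).trans ?_
            rw [abs_mul, abs_mul]
            gcongr
            · exact hβ e
            · exact hD v
            · exact hβ v
            · exact hD e
          · rw [abs_mul]
            gcongr
      _ ≤ N * (1 * (‖β‖ * ‖e‖ * (C1 * ‖v‖) + ‖β‖ * ‖v‖ * (C1 * ‖e‖)))
            + N * (C2 * ‖e‖ * ‖v‖) := by gcongr
      _ ≤ _ := by
          have : 0 ≤ N * (‖e‖ * ‖v‖) * (‖β‖ * C0 + C1) := by positivity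
          linarith

/-- The map `(∂_v Ψ) a - (∂_w Ψ) c` with scalar potential `Ψ`. -/
noncomputable def potentialMap (v w : E n) (a c : E m) (Ψ : E n → ℝ) (x : E n) : E m :=
  fderiv ℝ Ψ x v • a - fderiv ℝ Ψ x w • c

lemma IsTestFunction.potentialMap {Ω : Set (E n)} {Ψ : E n → ℝ} (hΨ : IsTestFunction Ω Ψ)
    (v w : E n) (a c : E m) : IsTestFunction Ω (potentialMap v w a c Ψ) :=
  hΨ.fderiv.clm_comp ((ContinuousLinearMap.apply ℝ ℝ v).smulRight a -
    (ContinuousLinearMap.apply ℝ ℝ w).smulRight c)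

lemma partialDeriv_potentialMap {Ω : Set (E n)} {Ψ : E n → ℝ} (hΨ : IsTestFunction Ω Ψ)
    (v w : E n) (a c : E m) (x : E n) (j : Fin n) :
    partialDeriv j (potentialMap v w a c Ψ) x =
      fderiv ℝ (fderiv ℝ Ψ) x (EuclideanSpace.single j 1) v • a -
        fderiv ℝ (fderiv ℝ Ψ) x (EuclideanSpace.single j 1) w • c := by
  have h1 := ((((ContinuousLinearMap.apply ℝ ℝ v).smulRight a -
    (ContinuousLinearMap.apply ℝ ℝ w).smulRight c).hasFDerivAt).comp x
      (hΨ.fderiv.differentiable x).hasFDerivAt).fderiv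
  unfold partialDeriv
  erw [h1]
  simp

/-- Contracting the gradient with `L` turns the two terms into `D²Ψ(w, v)` and `D²Ψ(v, w)`, which
cancel by symmetry of the second derivative. This is exact for any test function `Ψ`, so cutoffs do
no harm. -/
lemma inner_grad_potentialMap {Ω : Set (E n)} {Ψ : E n → ℝ} (hΨ : IsTestFunction Ω Ψ)
    (L : Matrix (Fin m) (Fin n) ℝ) (a c : E m) (x : E n) :
    inner ℝ (flatten L) (grad (potentialMap (WithLp.toLp 2 (Lᵀ *ᵥ c)) (WithLp.toLp 2 (Lᵀ *ᵥ a))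
      a c Ψ) x) = 0 := by
  set v : E n := WithLp.toLp 2 (Lᵀ *ᵥ c) with hv
  set w : E n := WithLp.toLp 2 (Lᵀ *ᵥ a) with hw
  set B := fderiv ℝ (fderiv ℝ Ψ) x with hB
  have hsymm : B w v = B v w :=
    (hΨ.1.contDiffAt.isSymmSndFDerivAt
      (minSmoothness_of_isRCLikeNormedField.trans_le (WithTop.coe_le_coe.2 le_top))) w v
  have hexp : ∀ y z : E n, B y z = ∑ j, y j * B (EuclideanSpace.single j 1) z := by
    intro y z
    conv_lhs => rw [← sum_smul_single y]
    simp
  have hvj : ∀ j, v j = ∑ i, L i j * c i := fun j => by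
    simp [hv, Matrix.mulVec, dotProduct]
  have hwj : ∀ j, w j = ∑ i, L i j * a i := fun j => by
    simp [hw, Matrix.mulVec, dotProduct]
  rw [inner_flatten, Finset.sum_comm]
  have hterm : ∀ j, ∑ i, L i j * grad (potentialMap v w a c Ψ) x (i, j) =
      w j * B (EuclideanSpace.single j 1) v - v j * B (EuclideanSpace.single j 1) w := by
    intro j
    rw [hvj, hwj, Finset.sum_mul, Finset.sum_mul, ← Finset.sum_sub_distrib]
    refine Finset.sum_congr rfl fun i _ => ?_
    rw [grad_apply, partialDeriv_potentialMap hΨ]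
    simp
    ring
  simp_rw [hterm]
  rw [Finset.sum_sub_distrib, ← hexp, ← hexp, hsymm, sub_self]

/-- Small oscillating maps, subject to the linear constraint, whose gradient is nearly parallel
to `a ⊗ b`. -/
lemma exists_oscillation (L : Matrix (Fin m) (Fin n) ℝ) (a : Fin m → ℝ) (b : Fin n → ℝ)
    (hLb : L *ᵥ b ≠ 0) (hLab : matDot L (Matrix.vecMulVec a b) = 0)
    {Ω : Set (E n)} {h : E n → ℝ} (hh : IsTestFunction Ω h) {δ : ℝ} (hδ : 0 < δ) :
    ∃ θ : E n → ℝ, Continuous θ ∧ ∀ τ : ℝ, ∃ φ : E n → E m, IsTestFunction Ω φ ∧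
      ∀ x, ‖φ x‖ ≤ δ ∧ inner ℝ (flatten L) (grad φ x) = 0 ∧
        ‖grad φ x - (Real.cos (θ x + τ) * h x) • flatten (Matrix.vecMulVec a b)‖ ≤ δ := by
  set β : E n := WithLp.toLp 2 b with hβ
  set c : Fin m → ℝ := L *ᵥ b with hc
  set v : E n := WithLp.toLp 2 (Lᵀ *ᵥ c) with hv
  set w : E n := WithLp.toLp 2 (Lᵀ *ᵥ a) with hw
  have hβv : inner ℝ β v = c ⬝ᵥ c := by
    simp only [hβ, hv, EuclideanSpace.inner_eq_star_dotProduct, star_trivial]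
    rw [Matrix.mulVec_transpose, ← Matrix.dotProduct_mulVec]
  have hβw : inner ℝ β w = 0 := by
    simp only [hβ, hw, EuclideanSpace.inner_eq_star_dotProduct, star_trivial]
    rw [← hLab, Matrix.mulVec_transpose, ← Matrix.dotProduct_mulVec]
    simp only [dotProduct, Matrix.mulVec, matDot, Matrix.vecMulVec_apply, Finset.mul_sum]
    refine Finset.sum_congr rfl fun i _ => Finset.sum_congr rfl fun j _ => by ring
  set κ : ℝ := c ⬝ᵥ c with hκ
  have hκ0 : 0 < κ := by
    rw [hκ]
    exact lt_of_le_of_ne (Finset.sum_nonneg fun i _ => mul_self_nonneg _)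
      fun h0 => hLb (dotProduct_self_eq_zero.1 h0.symm)
  obtain ⟨C, hC0, hC⟩ := exists_wave_bounds hh β
  set a' : E m := WithLp.toLp 2 a with ha'
  set c' : E m := WithLp.toLp 2 c with hc'
  set D : ℝ := κ⁻¹ * C * (‖v‖ * ‖a'‖ + ‖w‖ * ‖c'‖) with hD
  have hD0 : 0 ≤ D := by positivity
  -- Both the sup norm of the map and each entry of the gradient error will be at most `D / N`. The
  -- cardinality pays for bounding a norm by the sum of its entries; the extra `1` makes `Q`
  -- dominate `D` as well.
  set Q : ℝ := D * (1 + (Fintype.card (Fin m × Fin n) : ℝ)) with hQ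
  have hQ0 : 0 ≤ Q := by positivity
  set N : ℝ := 1 + Q / δ with hN
  have hN1 : 1 ≤ N := by rw [hN]; have : 0 ≤ Q / δ := by positivity
                         linarith
  have hNpos : 0 < N := by linarith
  have hQN : Q / N ≤ δ := by
    rw [div_le_iff₀ hNpos, hN]
    have : δ * (1 + Q / δ) = δ + Q := by field_simp
    rw [this]; linarith
  have hDN : D / N ≤ δ := by
    refine le_trans ?_ hQN
    gcongr
    rw [hQ]
    exact le_mul_of_one_le_right hD0 (le_add_of_nonneg_right (Nat.cast_nonneg _))
  refine ⟨fun x => N * inner ℝ β x, by fun_prop, fun τ => ?_⟩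
  -- Cancels the factor `-N²` of the leading second derivative and the factor `κ = ⟨β, v⟩`.
  set s : ℝ := -(N ^ 2 * κ)⁻¹ with hs
  have hs_abs : |s| = (N ^ 2 * κ)⁻¹ := by
    rw [hs, abs_neg, abs_of_nonneg (by positivity)]
  set Ψ : E n → ℝ := fun x => s • wave β h N τ x with hΨdef
  have hΨ : IsTestFunction Ω Ψ := (hh.wave β N τ).clm_comp (s • ContinuousLinearMap.id ℝ ℝ)
  have hwd := (hh.wave β N τ).differentiable
  have hwd2 := (hh.wave β N τ).fderiv.differentiable
  have hΨ1 : fderiv ℝ Ψ = fun x => s • fderiv ℝ (wave β h N τ) x := by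
    ext1 x
    exact fderiv_const_smul (hwd x) s
  have hΨ2 : ∀ x, fderiv ℝ (fderiv ℝ Ψ) x = s • fderiv ℝ (fderiv ℝ (wave β h N τ)) x := by
    intro x
    rw [hΨ1]
    exact fderiv_const_smul (hwd2 x) s
  refine ⟨potentialMap v w a' c' Ψ, hΨ.potentialMap v w a' c', fun x => ⟨?_, ?_, ?_⟩⟩
  · have hb : ∀ y : E n, |fderiv ℝ Ψ x y| ≤ κ⁻¹ * C * ‖y‖ / N := by
      intro y
      rw [hΨ1]
      simp only [_root_.smul_apply, smul_eq_mul, abs_mul, hs_abs]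
      calc _ ≤ (N ^ 2 * κ)⁻¹ * (C * N * ‖y‖) := by
            gcongr
            exact (hC N τ hN1 x 0 y).1
        _ = _ := by field_simp
    calc ‖potentialMap v w a' c' Ψ x‖ ≤ |fderiv ℝ Ψ x v| * ‖a'‖ + |fderiv ℝ Ψ x w| * ‖c'‖ := by
          refine (norm_sub_le _ _).trans ?_
          rw [norm_smul, norm_smul, Real.norm_eq_abs, Real.norm_eq_abs]
      _ ≤ κ⁻¹ * C * ‖v‖ / N * ‖a'‖ + κ⁻¹ * C * ‖w‖ / N * ‖c'‖ := by
          gcongr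
          · exact hb v
          · exact hb w
      _ = D / N := by rw [hD]; ring
      _ ≤ δ := hDN
  · exact inner_grad_potentialMap hΨ L a' c' x
  · refine le_trans ?_ hQN
    refine (norm_le_sum_abs _).trans ?_
    have hcard : Q / N = D / N + ∑ _p : Fin m × Fin n, D / N := by
      rw [Finset.sum_const, hQ, nsmul_eq_mul, Finset.card_univ]; ring
    rw [hcard]
    refine le_add_of_nonneg_of_le (by positivity) (Finset.sum_le_sum fun p _ => ?_)
    obtain ⟨i, j⟩ := p
    set ej : E n := EuclideanSpace.single j 1 with hej
    have hej1 : ‖ej‖ = 1 := by simp [hej]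
    have hβj : inner ℝ β ej = b j := by
      rw [hβ, hej, EuclideanSpace.inner_single_right]; simp
    set Z : ℝ := Real.cos (N * inner ℝ β x + τ) * h x with hZ
    have hb : ∀ y : E n, |fderiv ℝ (fderiv ℝ Ψ) x ej y - κ⁻¹ * (Z * b j * inner ℝ β y)| ≤
        κ⁻¹ * C * ‖y‖ / N := by
      intro y
      have h1 := (hC N τ hN1 x ej y).2
      rw [hΨ2, hβj] at *
      have e1 : (s • fderiv ℝ (fderiv ℝ (wave β h N τ)) x) ej y - κ⁻¹ * (Z * b j * inner ℝ β y) =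
          s * (fderiv ℝ (fderiv ℝ (wave β h N τ)) x ej y + N ^ 2 * (Z * b j * inner ℝ β y)) := by
        simp only [_root_.smul_apply, smul_eq_mul, hs]
        field_simp
        ring
      rw [e1, abs_mul, hs_abs]
      calc _ ≤ (N ^ 2 * κ)⁻¹ * (C * N * (‖ej‖ * ‖y‖)) := by
            gcongr
        _ = _ := by rw [hej1]; field_simp
    -- Here `⟨β, v⟩ = κ` turns the leading `a`-term into exactly `Z b_j a_i`, and `⟨β, w⟩ = 0`
    -- removes the leading `c`-term; only the `O(1/N)` remainders are left.
    have e2 : (grad (potentialMap v w a' c' Ψ) x - Z • flatten (Matrix.vecMulVec a b)) (i, j) =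
        (fderiv ℝ (fderiv ℝ Ψ) x ej v - κ⁻¹ * (Z * b j * inner ℝ β v)) * a i
        - (fderiv ℝ (fderiv ℝ Ψ) x ej w - κ⁻¹ * (Z * b j * inner ℝ β w)) * c i := by
      rw [PiLp.sub_apply, grad_apply, partialDeriv_potentialMap hΨ, hβv, hβw]
      simp [ha', hc', Matrix.vecMulVec_apply]
      field_simp
      ring
    rw [e2]
    have hai : |a i| ≤ ‖a'‖ := PiLp.norm_apply_le a' i
    have hci : |c i| ≤ ‖c'‖ := PiLp.norm_apply_le c' i
    calc _ ≤ κ⁻¹ * C * ‖v‖ / N * ‖a'‖ + κ⁻¹ * C * ‖w‖ / N * ‖c'‖ := by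
          refine (abs_sub _ _).trans ?_
          rw [abs_mul, abs_mul]
          gcongr
          · exact hb v
          · exact hb w
      _ = D / N := by rw [hD]; ring

end Oscillation

end Eikonal

namespace Eikonal

/-! ### One perturbation step -/

section Step

variable {m n : ℕ}

/-- By inner regularity a compact `K ⊆ Ω` misses little volume, and `χ = 1` on `K`. Since the defect
is at most `1`, the loss caused by the cutoff is at most `δ`. -/
lemma exists_cutoff {Ω : Set (E n)} (hΩ : IsOpen Ω) (hfin : volume Ω ≠ ⊤) {δ : ℝ} (hδ : 0 < δ) :
    ∃ χ : E n → ℝ, IsTestFunction Ω χ ∧ (∀ x, 0 ≤ χ x ∧ χ x ≤ 1) ∧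
      ∫ x in Ω, (1 - χ x ^ 2) ≤ δ := by
  obtain ⟨K, hKΩ, hK, hKδ⟩ := hΩ.measurableSet.exists_isCompact_sdiff_lt hfin
    (ENNReal.ofReal_pos.2 hδ).ne'
  obtain ⟨K', hK', hKK', hK'Ω⟩ := exists_compact_between hK hΩ hKΩ
  obtain ⟨χ, hχ, hrange, hsupp, hone⟩ :=
    exists_contMDiff_support_eq_eq_one_iff (n := (⊤ : ℕ∞)) (modelWithCornersSelf ℝ (E n))
      isOpen_interior hK.isClosed hKK'
  have h01 : ∀ x, 0 ≤ χ x ∧ χ x ≤ 1 := fun x => hrange (Set.mem_range_self x)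
  have hsub : tsupport χ ⊆ K' := closure_minimal (hsupp ▸ interior_subset) hK'.isClosed
  refine ⟨χ, ⟨hχ.contDiff, hK'.of_isClosed_subset (isClosed_tsupport _) hsub,
    hsub.trans hK'Ω⟩, h01, ?_⟩
  have hm : MeasurableSet (Ω \ K) := hΩ.measurableSet.diff hK.measurableSet
  have hle : ∀ x ∈ Ω, 1 - χ x ^ 2 ≤ (Ω \ K).indicator (fun _ => (1 : ℝ)) x := by
    intro x hx
    by_cases hxK : x ∈ K
    · simp [hxK, (hone x).1 hxK]
    · simp only [Set.indicator, Set.mem_sdiff, hx, hxK, not_false_eq_true, and_self, if_true]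
      nlinarith [sq_nonneg (χ x)]
  have hfin' : IsFiniteMeasure (volume.restrict Ω) := ⟨by simpa using hfin.lt_top⟩
  calc ∫ x in Ω, (1 - χ x ^ 2) ≤ ∫ x in Ω, (Ω \ K).indicator (fun _ => (1 : ℝ)) x := by
        refine setIntegral_mono_on ?_ ((integrable_const 1).indicator hm) hΩ.measurableSet hle
        refine Integrable.of_bound
          (continuous_const.sub (hχ.continuous.pow 2)).aestronglyMeasurable 1 (ae_of_all _ fun x => ?_)
        rw [Real.norm_eq_abs, abs_le]
        constructor <;> nlinarith [h01 x]
    _ = volume.real (Ω \ K) := by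
        rw [integral_indicator hm, Measure.restrict_restrict hm,
          Set.inter_eq_left.2 Set.sdiff_subset]
        simp
    _ ≤ δ := ENNReal.toReal_le_of_le_ofReal hδ.le hKδ.le

/-- The gradient of a test function has compact range, so the strict bound is uniform. The margin
`ρ` absorbs the error of the next oscillation. -/
lemma IsTestFunction.exists_norm_add_grad_le {Ω : Set (E n)} {w : E n → E m}
    (hw : IsTestFunction Ω w) (η : GradSpace m n) (hlt : ∀ x, ‖η + Eikonal.grad w x‖ < 1) :
    ∃ ρ, 0 < ρ ∧ ∀ x, ‖η + Eikonal.grad w x‖ ≤ 1 - ρ := by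
  have hcpt := hw.grad.2.1.isCompact_range hw.grad.1.continuous
  obtain ⟨ξ, ⟨x, rfl⟩, hx⟩ := hcpt.exists_isMaxOn (Set.range_nonempty _)
    (f := fun ξ => ‖η + ξ‖) (by fun_prop)
  exact ⟨1 - ‖η + Eikonal.grad w x‖, by linarith [hlt x],
    fun y => by
      have : ‖η + Eikonal.grad w y‖ ≤ ‖η + Eikonal.grad w x‖ := hx (Set.mem_range_self y)
      linarith⟩

/-- The component of a gradient orthogonal to `A`. -/
noncomputable def perp (A : GradSpace m n) : GradSpace m n →L[ℝ] GradSpace m n :=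
  (Submodule.span ℝ {A})ᗮ.starProjection

lemma perp_smul_self (A : GradSpace m n) (c : ℝ) : perp A (c • A) = 0 := by
  rw [perp, Submodule.starProjection_apply_eq_zero_iff, Submodule.orthogonal_orthogonal]
  exact Submodule.smul_mem _ _ (Submodule.mem_span_singleton_self A)

lemma norm_perp_le (A ξ : GradSpace m n) : ‖perp A ξ‖ ≤ ‖ξ‖ :=
  Submodule.norm_starProjection_apply_le _ _

lemma perp_eq_zero {A ξ : GradSpace m n} (h : perp A ξ = 0) : ∃ c : ℝ, ξ = c • A := by
  rw [perp, Submodule.starProjection_apply_eq_zero_iff, Submodule.orthogonal_orthogonal,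
    Submodule.mem_span_singleton] at h
  obtain ⟨c, hc⟩ := h
  exact ⟨c, hc.symm⟩

lemma sq_norm_ge_of_norm_sub_smul_le {A ξ : GradSpace m n} {c δ : ℝ} (h : ‖ξ - c • A‖ ≤ δ) :
    c ^ 2 * ‖A‖ ^ 2 ≤ 2 * ‖ξ‖ ^ 2 + 2 * δ ^ 2 := by
  have h1 : ‖c • A‖ ≤ ‖ξ‖ + δ := by
    calc ‖c • A‖ = ‖ξ - (ξ - c • A)‖ := by congr 1; abel
      _ ≤ _ := (norm_sub_le _ _).trans (by gcongr)
  have h2 : c ^ 2 * ‖A‖ ^ 2 = ‖c • A‖ ^ 2 := by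
    rw [norm_smul, mul_pow, Real.norm_eq_abs, sq_abs]
  rw [h2]
  have h0 := norm_nonneg (c • A)
  nlinarith [sq_nonneg (‖ξ‖ - δ), norm_nonneg ξ]

lemma flatten_vecMulVec_ne_zero {a : Fin m → ℝ} {b : Fin n → ℝ} (ha : a ≠ 0) (hb : b ≠ 0) :
    flatten (Matrix.vecMulVec a b) ≠ 0 := by
  intro h
  obtain ⟨i, hi⟩ := Function.ne_iff.1 ha
  obtain ⟨j, hj⟩ := Function.ne_iff.1 hb
  have hij := congrArg (fun v : GradSpace m n => v (i, j)) h
  exact mul_ne_zero hi hj hij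

/-- One step of the convex integration: an admissible map, with gradient of modulus less than `1`,
has a small perturbation which uses up a fixed part of the defect `1 - |∇u|²`. -/
lemma exists_perturbation (L : Matrix (Fin m) (Fin n) ℝ) (a : Fin m → ℝ) (b : Fin n → ℝ)
    (ha : a ≠ 0) (hLb : L *ᵥ b ≠ 0) (hLab : matDot L (Matrix.vecMulVec a b) = 0)
    {Ω : Set (E n)} (hΩ : IsOpen Ω) (hfin : volume Ω ≠ ⊤) (η : GradSpace m n)
    {w : E n → E m} (hw : IsTestFunction Ω w) (hlt : ∀ x, ‖η + grad w x‖ < 1)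
    {δ : ℝ} (hδ : 0 < δ) :
    ∃ φ : E n → E m, IsTestFunction Ω φ ∧
      (∀ x, ‖φ x‖ ≤ δ ∧ inner ℝ (flatten L) (grad φ x) = 0 ∧ ‖η + grad w x + grad φ x‖ < 1 ∧
        ‖perp (flatten (Matrix.vecMulVec a b)) (grad φ x)‖ ≤ δ) ∧
      ∫ x in Ω, (1 - ‖η + grad w x‖ ^ 2) ^ 2 ≤ 64 * (∫ x in Ω, ‖grad φ x‖ ^ 2) + δ := by
  have hfin' : IsFiniteMeasure (volume.restrict Ω) := ⟨by simpa using hfin.lt_top⟩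
  set A := flatten (Matrix.vecMulVec a b) with hA
  have hb : b ≠ 0 := by rintro rfl; simp at hLb
  have hA0 : 0 < ‖A‖ := norm_pos_iff.2 (flatten_vecMulVec_ne_zero ha hb)
  obtain ⟨ρ, hρ, hρle⟩ := hw.exists_norm_add_grad_le η hlt
  obtain ⟨χ, hχ, hχ01, hχint⟩ := exists_cutoff hΩ hfin (half_pos hδ)
  set f : E n → ℝ := fun x => 1 - ‖η + grad w x‖ ^ 2 with hf
  have hfsm : ContDiff ℝ ∞ f := contDiff_const.sub ((contDiff_const.add hw.grad.1).norm_sq ℝ)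
  have hfc : Continuous f := hfsm.continuous
  have hf0 : ∀ x, 0 ≤ f x := fun x => by
    have := norm_nonneg (η + grad w x)
    simp only [hf]; nlinarith [hlt x]
  have hf1 : ∀ x, f x ≤ 1 := fun x => by
    simp only [hf]; nlinarith [sq_nonneg ‖η + grad w x‖]
  -- The main term then has norm at most `f / 4 ≤ (1 - |F|) / 2`, where `F = η + ∇w`: at most half
  -- the distance to the unit sphere. The other half, at least `ρ / 2`, exceeds the error `ρ / 4`.
  set h : E n → ℝ := fun x => χ x * (f x / (4 * ‖A‖)) with hh
  have hhtest : IsTestFunction Ω h :=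
    ⟨hχ.1.mul (hfsm.div_const _), hχ.2.1.mul_right, tsupport_mul_subset_left.trans hχ.2.2⟩
  set V : ℝ := volume.real Ω with hV
  have hV0 : 0 ≤ V := measureReal_nonneg
  set δ' : ℝ := min (min δ (ρ / 4)) (min 1 (δ / (128 * (V + 1)))) with hδ'
  have hδ'0 : 0 < δ' := by
    refine lt_min (lt_min hδ (by linarith)) (lt_min one_pos ?_)
    positivity
  have hδ'1 : δ' ≤ δ := (min_le_left _ _).trans (min_le_left _ _)
  have hδ'2 : δ' ≤ ρ / 4 := (min_le_left _ _).trans (min_le_right _ _)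
  have hδ'3 : δ' ≤ 1 := (min_le_right _ _).trans (min_le_left _ _)
  have hδ'4 : 64 * (δ' ^ 2 * V) ≤ δ / 2 := by
    have h1 : δ' ≤ δ / (128 * (V + 1)) := (min_le_right _ _).trans (min_le_right _ _)
    rw [le_div_iff₀ (by positivity)] at h1
    have h2 : δ' ^ 2 ≤ δ' := by nlinarith
    nlinarith [mul_le_mul_of_nonneg_right h2 hV0]
  obtain ⟨θ, hθ, hφ⟩ := exists_oscillation L a b hLb hLab hhtest hδ'0
  have hint : ∀ g : E n → ℝ, Continuous g → (∀ x, |g x| ≤ 1) →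
      Integrable g (volume.restrict Ω) := fun g hg hg1 =>
    Integrable.of_bound hg.aestronglyMeasurable 1 (ae_of_all _ hg1)
  have hχf : ∀ x, 0 ≤ χ x ^ 2 * f x ^ 2 ∧ χ x ^ 2 * f x ^ 2 ≤ 1 := fun x =>
    ⟨by positivity, mul_le_one₀ (pow_le_one₀ (hχ01 x).1 (hχ01 x).2) (by positivity)
      (pow_le_one₀ (hf0 x) (hf1 x))⟩
  have hχfc : Continuous fun x => χ x ^ 2 * f x ^ 2 := (hχ.1.continuous.pow 2).mul (hfc.pow 2)
  have hintc : ∀ g : E n → ℝ, Continuous g → (∀ x, 0 ≤ g x ∧ g x ≤ 1) →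
      Integrable (fun x => g x * (χ x ^ 2 * f x ^ 2)) (volume.restrict Ω) := fun g hg hg1 =>
    hint _ (hg.mul hχfc) fun x => by
      rw [abs_of_nonneg (mul_nonneg (hg1 x).1 (hχf x).1)]
      exact mul_le_one₀ (hg1 x).2 (hχf x).1 (hχf x).2
  have hcos : ∀ τ x, 0 ≤ Real.cos (θ x + τ) ^ 2 ∧ Real.cos (θ x + τ) ^ 2 ≤ 1 := fun τ x =>
    ⟨sq_nonneg _, Real.cos_sq_le_one _⟩
  have hcosc : ∀ τ, Continuous fun x => Real.cos (θ x + τ) ^ 2 := fun τ => by fun_prop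
  -- Since `cos² + sin² = 1`, one of the phases `0` and `π / 2` captures at least half of the
  -- integral; no limit of large frequency is needed.
  obtain ⟨τ, hτ⟩ : ∃ τ : ℝ, ∫ x in Ω, χ x ^ 2 * f x ^ 2 ≤
      2 * ∫ x in Ω, Real.cos (θ x + τ) ^ 2 * (χ x ^ 2 * f x ^ 2) := by
    have hsum : ∫ x in Ω, χ x ^ 2 * f x ^ 2 =
        (∫ x in Ω, Real.cos (θ x + 0) ^ 2 * (χ x ^ 2 * f x ^ 2)) +
        ∫ x in Ω, Real.cos (θ x + Real.pi / 2) ^ 2 * (χ x ^ 2 * f x ^ 2) := by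
      rw [← integral_add (hintc _ (hcosc _) (hcos _)) (hintc _ (hcosc _) (hcos _))]
      congr 1 with x
      rw [Real.cos_add_pi_div_two, add_zero, neg_sq, ← add_mul, Real.cos_sq_add_sin_sq, one_mul]
    by_contra! hcon
    have h1 := hcon 0
    have h2 := hcon (Real.pi / 2)
    linarith
  obtain ⟨φ, hφt, hφx⟩ := hφ τ
  have hhA : ∀ x, (Real.cos (θ x + τ) * h x) ^ 2 * ‖A‖ ^ 2 =
      Real.cos (θ x + τ) ^ 2 * (χ x ^ 2 * f x ^ 2) / 16 := by
    intro x
    simp only [hh]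
    field_simp
    ring
  refine ⟨φ, hφt, fun x => ⟨(hφx x).1.trans hδ'1, (hφx x).2.1, ?_, ?_⟩, ?_⟩
  · have hsplit : η + grad w x + grad φ x = (η + grad w x) + (Real.cos (θ x + τ) * h x) • A +
        (grad φ x - (Real.cos (θ x + τ) * h x) • A) := by abel
    have hF := norm_nonneg (η + grad w x)
    have hs : ‖(Real.cos (θ x + τ) * h x) • A‖ ≤ f x / 4 := by
      rw [norm_smul, Real.norm_eq_abs, abs_mul]
      have hh0 : 0 ≤ h x := mul_nonneg (hχ01 x).1 (div_nonneg (hf0 x) (by positivity))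
      rw [abs_of_nonneg hh0]
      calc |Real.cos (θ x + τ)| * h x * ‖A‖ ≤ 1 * (1 * (f x / (4 * ‖A‖))) * ‖A‖ := by
            gcongr
            · exact Real.abs_cos_le_one _
            · exact mul_le_mul_of_nonneg_right (hχ01 x).2 (div_nonneg (hf0 x) (by positivity))
        _ = f x / 4 := by field_simp
    have hfx : f x ≤ 2 * (1 - ‖η + grad w x‖) := by
      simp only [hf]; nlinarith [hlt x]
    have h3 := norm_add₃_le (a := η + grad w x) (b := (Real.cos (θ x + τ) * h x) • A)
      (c := grad φ x - (Real.cos (θ x + τ) * h x) • A)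
    rw [hsplit]
    linarith [(hφx x).2.2, hρle x]
  · have h1 : perp A (grad φ x) = perp A (grad φ x - (Real.cos (θ x + τ) * h x) • A) := by
      rw [map_sub, perp_smul_self, sub_zero]
    rw [h1]
    exact ((norm_perp_le _ _).trans (hφx x).2.2).trans hδ'1
  · have hgi : Integrable (fun x => ‖grad φ x‖ ^ 2) (volume.restrict Ω) :=
      (hφt.grad.memLp 2).integrable_norm_pow (by norm_num)
    have hpt : ∀ x, f x ^ 2 ≤ (1 - χ x ^ 2) + χ x ^ 2 * f x ^ 2 := by
      intro x
      have h1 : χ x ^ 2 ≤ 1 := pow_le_one₀ (hχ01 x).1 (hχ01 x).2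
      have h2 : f x ^ 2 ≤ 1 := pow_le_one₀ (hf0 x) (hf1 x)
      nlinarith
    have hi1 : Integrable (fun x => 1 - χ x ^ 2) (volume.restrict Ω) :=
      hint _ (continuous_const.sub (hχ.1.continuous.pow 2)) fun x => by
        rw [abs_le]
        constructor <;> nlinarith [hχ01 x]
    have hi2 : Integrable (fun x => χ x ^ 2 * f x ^ 2) (volume.restrict Ω) :=
      hint _ hχfc fun x => by rw [abs_of_nonneg (hχf x).1]; exact (hχf x).2
    have hi3 : Integrable (fun x => f x ^ 2) (volume.restrict Ω) :=
      hint _ (hfc.pow 2) fun x => by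
        rw [abs_of_nonneg (sq_nonneg _)]; exact pow_le_one₀ (hf0 x) (hf1 x)
    have hI1 : ∫ x in Ω, f x ^ 2 ≤ δ / 2 + ∫ x in Ω, χ x ^ 2 * f x ^ 2 := by
      calc _ ≤ ∫ x in Ω, ((1 - χ x ^ 2) + χ x ^ 2 * f x ^ 2) :=
            integral_mono hi3 (hi1.add hi2) hpt
        _ ≤ _ := by rw [integral_add hi1 hi2]; gcongr
    -- The factor `32` is `16 = 4²` from the amplitude times `2` from splitting the square; the
    -- choice of phase doubles it to `64`.
    have hI2 : ∫ x in Ω, Real.cos (θ x + τ) ^ 2 * (χ x ^ 2 * f x ^ 2) ≤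
        32 * (∫ x in Ω, ‖grad φ x‖ ^ 2) + 32 * (δ' ^ 2 * V) := by
      calc _ ≤ ∫ x in Ω, (32 * ‖grad φ x‖ ^ 2 + 32 * δ' ^ 2) := by
            refine integral_mono (hintc _ (hcosc _) (hcos _))
              ((hgi.const_mul 32).add (integrable_const _)) fun x => ?_
            have := sq_norm_ge_of_norm_sub_smul_le (hφx x).2.2
            rw [hhA x] at this
            simp only
            linarith
        _ = _ := by
            rw [integral_add (hgi.const_mul 32) (integrable_const _), integral_const_mul]
            simp [hV]
            ring
    change ∫ x in Ω, f x ^ 2 ≤ _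
    linarith

end Step

end Eikonal

/-- By Pythagoras up to a summable error, the squared norms of the increments telescope against the
bounded `‖g k‖²`, so they are summable. Almost orthogonality to every earlier `g i`, not just the
last, then bounds `‖g (k + d) - g k‖²` by a tail of a convergent series. -/
lemma cauchySeq_of_almost_orthogonal {H : Type*} [NormedAddCommGroup H] [InnerProductSpace ℝ H]
    {g : ℕ → H} {ε : ℕ → ℝ} (hε : Summable ε) {B : ℝ} (hB : ∀ k, ‖g k‖ ≤ B)
    (h : ∀ i k, i ≤ k → |inner ℝ (g i) (g (k + 1) - g k)| ≤ ε k) : CauchySeq g := by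
  have hε0 : ∀ k, 0 ≤ ε k := fun k => (abs_nonneg _).trans (h k k le_rfl)
  have hstep : ∀ k, ‖g (k + 1) - g k‖ ^ 2 ≤ ‖g (k + 1)‖ ^ 2 - ‖g k‖ ^ 2 + 2 * ε k := by
    intro k
    have h1 : ‖g (k + 1)‖ ^ 2 = ‖g k + (g (k + 1) - g k)‖ ^ 2 := by congr 2; abel
    rw [norm_add_sq_real] at h1
    have h2 := (abs_le.1 (h k k le_rfl)).1
    linarith
  have hsum : Summable fun k => ‖g (k + 1) - g k‖ ^ 2 := by
    refine summable_of_sum_range_le (c := B ^ 2 + 2 * ∑' k, ε k) (fun k => sq_nonneg _) fun N => ?_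
    calc _ ≤ ∑ k ∈ Finset.range N, ((‖g (k + 1)‖ ^ 2 - ‖g k‖ ^ 2) + 2 * ε k) :=
          Finset.sum_le_sum fun k _ => hstep k
      _ = (‖g N‖ ^ 2 - ‖g 0‖ ^ 2) + 2 * ∑ k ∈ Finset.range N, ε k := by
          rw [Finset.sum_add_distrib, Finset.sum_range_sub (fun k => ‖g k‖ ^ 2), Finset.mul_sum]
      _ ≤ _ := by
          have h1 := hε.sum_le_tsum (Finset.range N) fun k _ => hε0 k
          have h2 : ‖g N‖ ^ 2 ≤ B ^ 2 := pow_le_pow_left₀ (norm_nonneg _) (hB N) 2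
          nlinarith [sq_nonneg ‖g 0‖]
  -- The cross term is twice the inner product with `g (k + d) - g k`, and each of these two vectors
  -- contributes at most one `ε`.
  set t : ℕ → ℝ := fun k => ‖g (k + 1) - g k‖ ^ 2 + 4 * ε k with ht
  have htsum : Summable t := hsum.add (hε.mul_left 4)
  have hT := htsum.hasSum.tendsto_sum_nat.cauchySeq
  have hle : ∀ k d, ‖g (k + d) - g k‖ ^ 2 ≤
      ∑ l ∈ Finset.range (k + d), t l - ∑ l ∈ Finset.range k, t l := by
    intro k d
    induction d with
    | zero => simp
    | succ d ih =>
      rw [← add_assoc, Finset.sum_range_succ]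
      have e1 : g (k + d + 1) - g k = (g (k + d) - g k) + (g (k + d + 1) - g (k + d)) := by abel
      rw [e1, norm_add_sq_real, inner_sub_left]
      have h1 := (abs_le.1 (h (k + d) (k + d) le_rfl)).2
      have h2 := (abs_le.1 (h k (k + d) (by omega))).1
      simp only [ht] at ih ⊢
      linarith
  rw [Metric.cauchySeq_iff'] at hT ⊢
  intro r hr
  obtain ⟨N, hN⟩ := hT (r ^ 2) (by positivity)
  refine ⟨N, fun k hk => ?_⟩
  obtain ⟨d, rfl⟩ := Nat.exists_eq_add_of_le hk
  have h1 := hN (N + d) hk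
  rw [Real.dist_eq] at h1
  rw [dist_eq_norm]
  exact lt_of_pow_lt_pow_left₀ 2 hr.le
    ((hle N d).trans_lt ((le_abs_self _).trans_lt h1))

namespace Eikonal

/-! ### Iteration and passage to the limit -/

section Iteration

variable {m n : ℕ}

/-- Perturbations of an affine map with gradient `η` whose gradients satisfy the linear constraint
and have modulus less than `1`. -/
structure IsAdmissible (Ω : Set (E n)) (L : Matrix (Fin m) (Fin n) ℝ) (η : GradSpace m n)
    (w : E n → E m) : Prop where
  test : IsTestFunction Ω w
  constraint : ∀ x, inner ℝ (flatten L) (grad w x) = 0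
  norm_lt : ∀ x, ‖η + grad w x‖ < 1

/-- Each tolerance is chosen after the current map is known, so it can beat the integration-by-parts
constants of all maps built so far. This yields the near orthogonality. -/
lemma exists_admissible_seq (L : Matrix (Fin m) (Fin n) ℝ) (a : Fin m → ℝ) (b : Fin n → ℝ)
    (ha : a ≠ 0) (hLb : L *ᵥ b ≠ 0) (hLab : matDot L (Matrix.vecMulVec a b) = 0)
    {Ω : Set (E n)} (hΩ : IsOpen Ω) (hfin : volume Ω ≠ ⊤) (η : GradSpace m n) (hη : ‖η‖ < 1)
    {δ : ℝ} (hδ : 0 < δ) :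
    ∃ w : ℕ → E n → E m, w 0 = 0 ∧ (∀ k, IsAdmissible Ω L η (w k)) ∧
      (∀ k x, ‖w (k + 1) x - w k x‖ ≤ δ * (1 / 2) ^ (k + 1)) ∧
      (∀ k x, ‖perp (flatten (Matrix.vecMulVec a b)) (grad (w (k + 1)) x - grad (w k) x)‖ ≤
        δ * (1 / 2) ^ (k + 1)) ∧
      (∀ i k, i ≤ k → |∫ x in Ω, inner ℝ (grad (w i) x) (grad (w (k + 1)) x - grad (w k) x)| ≤
        δ * (1 / 2) ^ (k + 1)) ∧
      ∀ k, ∫ x in Ω, (1 - ‖η + grad (w k) x‖ ^ 2) ^ 2 ≤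
        64 * (∫ x in Ω, ‖grad (w (k + 1)) x - grad (w k) x‖ ^ 2) + δ * (1 / 2) ^ (k + 1) := by
  choose C hC0 hC using fun w : {w : E n → E m // IsAdmissible Ω L η w} =>
    exists_abs_integral_inner_grad_le w.2.test
  choose φ hφt hφx hφI using fun (w : {w : E n → E m // IsAdmissible Ω L η w})
    (d : {d : ℝ // 0 < d}) =>
    exists_perturbation L a b ha hLb hLab hΩ hfin η w.2.test w.2.norm_lt d.2
  have hga : ∀ w d x, grad (fun y => w.1 y + φ w d y) x = grad w.1 x + grad (φ w d) x :=
    fun w d x => grad_add w.2.test.differentiable (hφt w d).differentiable x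
  have hadm : ∀ w d, IsAdmissible Ω L η (fun x => w.1 x + φ w d x) := fun w d =>
    { test := w.2.test.add (hφt w d)
      constraint := fun x => by
        rw [hga, inner_add_right, w.2.constraint, (hφx w d x).2.1, add_zero]
      norm_lt := fun x => by
        rw [hga, ← add_assoc]
        exact (hφx w d x).2.2.1 }
  have hgrad0 : ∀ x, grad (0 : E n → E m) x = 0 := fun x => by
    rw [grad_eq]; simp
  have hadm0 : IsAdmissible Ω L η (0 : E n → E m) :=
    { test := IsTestFunction.zero
      constraint := fun x => by rw [hgrad0, inner_zero_right]
      norm_lt := fun x => by rwa [hgrad0, add_zero] }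
  have hCpos : ∀ w, 0 < 2 * (1 + C w) := fun w => by linarith [hC0 w]
  -- Division by `1 + C` beats the constant of the current map; the factor `2` gives geometric
  -- decay, which keeps that gain at every later step.
  let nd : {w : E n → E m // IsAdmissible Ω L η w} × {d : ℝ // 0 < d} → {d : ℝ // 0 < d} :=
    fun s => ⟨s.2.1 / (2 * (1 + C s.1)), div_pos s.2.2 (hCpos _)⟩
  let next : {w : E n → E m // IsAdmissible Ω L η w} × {d : ℝ // 0 < d} →
      {w : E n → E m // IsAdmissible Ω L η w} × {d : ℝ // 0 < d} :=
    fun s => (⟨fun x => s.1.1 x + φ s.1 (nd s) x, hadm _ _⟩, nd s)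
  let S : ℕ → {w : E n → E m // IsAdmissible Ω L η w} × {d : ℝ // 0 < d} :=
    fun k => next^[k] (⟨0, hadm0⟩, ⟨δ, hδ⟩)
  have hS : ∀ k, S (k + 1) = next (S k) := fun k => Function.iterate_succ_apply' _ _ _
  have hd : ∀ k, (S (k + 1)).2.1 = (S k).2.1 / (2 * (1 + C (S k).1)) := fun k => by rw [hS]
  have hd_half : ∀ k, (S (k + 1)).2.1 ≤ (S k).2.1 / 2 := fun k => by
    rw [hd]
    exact div_le_div_of_nonneg_left (S k).2.2.le two_pos (by linarith [hC0 (S k).1])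
  have hd_le : ∀ k, (S k).2.1 ≤ δ * (1 / 2) ^ k := by
    intro k
    induction k with
    | zero => simp [S]
    | succ k ih =>
      rw [pow_succ]
      linarith [hd_half k]
  have hd_C : ∀ i d, (1 + C (S i).1) * (S (i + d + 1)).2.1 ≤ δ * (1 / 2) ^ (i + d + 1) := by
    intro i d
    induction d with
    | zero =>
      rw [add_zero, hd, pow_succ]
      have h1 := hCpos (S i).1
      have h2 : (1 + C (S i).1) * ((S i).2.1 / (2 * (1 + C (S i).1))) = (S i).2.1 / 2 := by
        have : 1 + C (S i).1 ≠ 0 := by linarith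
        field_simp
      rw [h2]
      linarith [hd_le i]
    | succ d ih =>
      have h1 : 0 ≤ 1 + C (S i).1 := by linarith [hC0 (S i).1]
      have h2 := mul_le_mul_of_nonneg_left (hd_half (i + d + 1)) h1
      rw [← add_assoc i d 1, pow_succ]
      linarith
  have hdiff : ∀ k x, (S (k + 1)).1.1 x - (S k).1.1 x = φ (S k).1 (S (k + 1)).2 x := fun k x => by
    rw [hS]; simp [next]
  have hgdiff : ∀ k x, grad (S (k + 1)).1.1 x - grad (S k).1.1 x =
      grad (φ (S k).1 (S (k + 1)).2) x := fun k x => by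
    rw [hS]
    simp only [next]
    rw [hga, add_sub_cancel_left]
  refine ⟨fun k => (S k).1.1, rfl, fun k => (S k).1.2, fun k x => ?_, fun k x => ?_,
    fun i k hik => ?_, fun k => ?_⟩
  · rw [hdiff]
    exact (hφx _ _ x).1.trans (hd_le (k + 1))
  · rw [hgdiff]
    exact (hφx _ _ x).2.2.2.trans (hd_le (k + 1))
  · simp_rw [hgdiff]
    refine (hC (S i).1 _ (hφt _ _) _ fun x => (hφx (S k).1 (S (k + 1)).2 x).1).trans ?_
    obtain ⟨d, rfl⟩ := Nat.exists_eq_add_of_le hik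
    refine le_trans ?_ (hd_C i d)
    have := (S (i + d + 1)).2.2
    linarith
  · simp_rw [hgdiff]
    refine (hφI (S k).1 (S (k + 1)).2).trans ?_
    gcongr
    exact hd_le (k + 1)

/-- The limit of the convex integration. -/
lemma exists_limit (L : Matrix (Fin m) (Fin n) ℝ) (a : Fin m → ℝ) (b : Fin n → ℝ)
    (ha : a ≠ 0) (hLb : L *ᵥ b ≠ 0) (hLab : matDot L (Matrix.vecMulVec a b) = 0)
    {Ω : Set (E n)} (hΩ : IsOpen Ω) (hfin : volume Ω ≠ ⊤) (η : GradSpace m n) (hη : ‖η‖ < 1)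
    {δ : ℝ} (hδ : 0 < δ) :
    ∃ (w : ℕ → E n → E m) (z : E n → E m) (G : E n → GradSpace m n),
      (∀ k, IsTestFunction Ω (w k)) ∧
      AEStronglyMeasurable z (volume.restrict Ω) ∧ (∀ x, ‖z x‖ ≤ δ) ∧
      AEStronglyMeasurable G (volume.restrict Ω) ∧
      Tendsto (fun k => eLpNorm (w k - z) 1 (volume.restrict Ω)) atTop (𝓝 0) ∧
      Tendsto (fun k => eLpNorm (grad (w k) - G) 1 (volume.restrict Ω)) atTop (𝓝 0) ∧
      ∀ᵐ x ∂(volume.restrict Ω), ‖η + G x‖ = 1 ∧ inner ℝ (flatten L) (G x) = 0 ∧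
        ‖perp (flatten (Matrix.vecMulVec a b)) (G x)‖ ≤ δ := by
  obtain ⟨w, hw0, hadm, hdiff, hperp, horth, hdef⟩ :=
    exists_admissible_seq L a b ha hLb hLab hΩ hfin η hη hδ
  set μ := volume.restrict Ω with hμ
  have hfin' : IsFiniteMeasure μ := ⟨by simpa [hμ] using hfin.lt_top⟩
  have hpow : ∀ k, δ * (1 / 2 : ℝ) ^ (k + 1) = δ / 2 * (1 / 2) ^ k := fun k => by
    rw [pow_succ]; ring
  have hhalf : (1 / 2 : ℝ) < 1 := by norm_num
  have hwdist : ∀ x k, dist (w k x) (w (k + 1) x) ≤ δ / 2 * (1 / 2) ^ k := fun x k => by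
    rw [dist_comm, dist_eq_norm, ← hpow]; exact hdiff k x
  choose z hz using fun x => cauchySeq_tendsto_of_complete
    (cauchySeq_of_le_geometric _ _ hhalf (hwdist x))
  have hz0 : ∀ x, ‖z x‖ ≤ δ := fun x => by
    have := dist_le_of_le_geometric_of_tendsto₀ _ _ hhalf (hwdist x) (hz x)
    rw [hw0, Pi.zero_apply, dist_zero_left] at this
    exact this.trans_eq (by ring)
  have hzk : ∀ k x, ‖(w k - z) x‖ ≤ δ * (1 / 2) ^ k := fun k x => by
    have := dist_le_of_le_geometric_of_tendsto _ _ hhalf (hwdist x) (hz x) k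
    rw [dist_eq_norm] at this
    refine this.trans_eq ?_
    ring
  have hzm : AEStronglyMeasurable z μ :=
    aestronglyMeasurable_of_tendsto_ae atTop
      (fun k => (hadm k).test.1.continuous.aestronglyMeasurable) (ae_of_all _ hz)
  have hgL2 : ∀ k, MemLp (grad (w k)) 2 μ := fun k => (hadm k).test.grad.memLp 2
  set g : ℕ → Lp (GradSpace m n) 2 μ := fun k => (hgL2 k).toLp with hg
  have hinner : ∀ f₁ f₂ : E n → GradSpace m n, ∀ (h₁ : MemLp f₁ 2 μ) (h₂ : MemLp f₂ 2 μ),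
      inner ℝ h₁.toLp h₂.toLp = ∫ x, inner ℝ (f₁ x) (f₂ x) ∂μ := by
    intro f₁ f₂ h₁ h₂
    rw [L2.inner_def]
    refine integral_congr_ae ?_
    filter_upwards [h₁.coeFn_toLp, h₂.coeFn_toLp] with x e₁ e₂
    rw [e₁, e₂]
  have hgsub : ∀ k, g (k + 1) - g k = ((hgL2 (k + 1)).sub (hgL2 k)).toLp := fun k =>
    ((hgL2 (k + 1)).toLp_sub (hgL2 k)).symm
  have hgnorm2 : ∀ k x, ‖grad (w k) x‖ ≤ 2 := fun k x => by
    calc ‖grad (w k) x‖ = ‖(η + grad (w k) x) - η‖ := by congr 1; abel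
      _ ≤ 2 := (norm_sub_le _ _).trans (by linarith [(hadm k).norm_lt x])
  have hgcauchy : CauchySeq g := by
    refine cauchySeq_of_almost_orthogonal (ε := fun k => δ / 2 * (1 / 2) ^ k)
      ((summable_geometric_of_lt_one (by norm_num) hhalf).mul_left _)
      (B := Real.sqrt (μ.real Set.univ * 4)) (fun k => ?_) fun i k hik => ?_
    · refine Real.le_sqrt_of_sq_le ?_
      rw [← real_inner_self_eq_norm_sq, hinner]
      calc ∫ x, inner ℝ (grad (w k) x) (grad (w k) x) ∂μ ≤ ∫ _, (4 : ℝ) ∂μ := by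
            refine integral_mono_of_nonneg (ae_of_all _ fun x => real_inner_self_nonneg)
              (integrable_const _) (ae_of_all _ fun x => ?_)
            simp only [real_inner_self_eq_norm_sq]
            nlinarith [hgnorm2 k x, norm_nonneg (grad (w k) x)]
        _ = _ := by simp
    · rw [hgsub, hinner, ← hpow]
      exact horth i k hik
  obtain ⟨G', hG'⟩ := cauchySeq_tendsto_of_complete hgcauchy
  obtain ⟨G, hG⟩ : ∃ G : E n → GradSpace m n, G = ⇑G' := ⟨_, rfl⟩
  have hGm : AEStronglyMeasurable G μ := hG ▸ (Lp.memLp G').1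
  have hG2 : Tendsto (fun k => eLpNorm (grad (w k) - G) 2 μ) atTop (𝓝 0) := by
    subst hG
    rw [← Lp.tendsto_Lp_iff_tendsto_eLpNorm'' _ hgL2 _ (Lp.memLp G'), Lp.toLp_coeFn]
    exact hG'
  have hG1 : Tendsto (fun k => eLpNorm (grad (w k) - G) 1 μ) atTop (𝓝 0) := by
    have hb : ∀ k, eLpNorm (grad (w k) - G) 1 μ ≤ eLpNorm (grad (w k) - G) 2 μ *
        μ Set.univ ^ (1 / (1 : ℝ≥0∞).toReal - 1 / (2 : ℝ≥0∞).toReal) := fun k =>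
      eLpNorm_le_eLpNorm_mul_rpow_measure_univ (by norm_num) ((hgL2 k).1.sub hGm)
    refine tendsto_of_tendsto_of_tendsto_of_le_of_le tendsto_const_nhds ?_ (fun _ => zero_le) hb
    have := ENNReal.Tendsto.mul_const hG2 (b := μ Set.univ ^ (1 / (1 : ℝ≥0∞).toReal -
      1 / (2 : ℝ≥0∞).toReal)) (Or.inr (ENNReal.rpow_ne_top_of_nonneg (by norm_num)
        (measure_ne_top _ _)))
    rwa [zero_mul] at this
  have hz1 : Tendsto (fun k => eLpNorm (w k - z) 1 μ) atTop (𝓝 0) := by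
    have hb : ∀ k, eLpNorm (w k - z) 1 μ ≤
        μ Set.univ ^ (1 : ℝ≥0∞).toReal⁻¹ * ENNReal.ofReal (δ * (1 / 2) ^ k) := fun k =>
      eLpNorm_le_of_ae_bound (ae_of_all _ (hzk k))
    refine tendsto_of_tendsto_of_tendsto_of_le_of_le tendsto_const_nhds ?_ (fun _ => zero_le) hb
    have h1 : Tendsto (fun k : ℕ => ENNReal.ofReal (δ * (1 / 2 : ℝ) ^ k)) atTop (𝓝 0) := by
      rw [← ENNReal.ofReal_zero]
      refine ENNReal.tendsto_ofReal ?_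
      simpa using (tendsto_pow_atTop_nhds_zero_of_lt_one (by norm_num) hhalf).const_mul δ
    have := ENNReal.Tendsto.const_mul h1 (a := μ Set.univ ^ (1 : ℝ≥0∞).toReal⁻¹)
      (Or.inr (ENNReal.rpow_ne_top_of_nonneg (by norm_num) (measure_ne_top _ _)))
    rwa [mul_zero] at this
  -- Pointwise convergence of the gradients is only available along a subsequence, which suffices to
  -- identify the limit of the defect and of the linear constraint.
  obtain ⟨ns, hns, hae⟩ := (tendstoInMeasure_of_tendsto_eLpNorm two_ne_zero
    (fun k => (hgL2 k).1) hGm hG2).exists_seq_tendsto_ae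
  have hsq : Tendsto (fun k => ∫ x, ‖grad (w (k + 1)) x - grad (w k) x‖ ^ 2 ∂μ) atTop (𝓝 0) := by
    have h1 : Tendsto (fun k => ‖g (k + 1) - g k‖ ^ 2) atTop (𝓝 0) := by
      have := ((hG'.comp (tendsto_add_atTop_nat 1)).sub hG').norm.pow 2
      simpa using this
    refine h1.congr fun k => ?_
    rw [← real_inner_self_eq_norm_sq, hgsub, hinner]
    congr 1 with x
    rw [real_inner_self_eq_norm_sq]
    rfl
  have hdef0 : Tendsto (fun k => ∫ x, (1 - ‖η + grad (w k) x‖ ^ 2) ^ 2 ∂μ) atTop (𝓝 0) := by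
    refine tendsto_of_tendsto_of_tendsto_of_le_of_le tendsto_const_nhds ?_
      (fun k => integral_nonneg fun x => sq_nonneg _) hdef
    have h1 := (tendsto_pow_atTop_nhds_zero_of_lt_one (by norm_num) hhalf).const_mul (δ / 2)
    have h2 := (hsq.const_mul 64).add h1
    simp_rw [hpow]
    simpa using h2
  have hdefb : ∀ k x, 0 ≤ (1 - ‖η + grad (w k) x‖ ^ 2) ^ 2 ∧
      (1 - ‖η + grad (w k) x‖ ^ 2) ^ 2 ≤ 1 := fun k x => by
    have h1 := (hadm k).norm_lt x
    have h2 := norm_nonneg (η + grad (w k) x)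
    refine ⟨sq_nonneg _, pow_le_one₀ ?_ ?_⟩ <;> nlinarith
  have hlimdef : ∀ᵐ x ∂μ, Tendsto (fun k => (1 - ‖η + grad (w (ns k)) x‖ ^ 2) ^ 2) atTop
      (𝓝 ((1 - ‖η + G x‖ ^ 2) ^ 2)) := by
    filter_upwards [hae] with x hx
    exact (((hx.const_add η).norm.pow 2).const_sub 1).pow 2
  have hzero : ∫ x, (1 - ‖η + G x‖ ^ 2) ^ 2 ∂μ = 0 := by
    refine tendsto_nhds_unique ?_ (hdef0.comp hns.tendsto_atTop)
    refine tendsto_integral_of_dominated_convergence (fun _ => 1) (fun k => ?_)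
      (integrable_const _) (fun k => ae_of_all _ fun x => ?_) hlimdef
    · have := (hadm (ns k)).test.grad.1.continuous
      exact Continuous.aestronglyMeasurable (by fun_prop)
    · rw [Real.norm_of_nonneg (hdefb _ x).1]
      exact (hdefb _ x).2
  have hint : Integrable (fun x => (1 - ‖η + G x‖ ^ 2) ^ 2) μ := by
    refine Integrable.of_bound
      (((aestronglyMeasurable_const.sub ((aestronglyMeasurable_const.add hGm).norm.pow 2))).pow 2)
      1 ?_
    filter_upwards [hlimdef] with x hx
    rw [Real.norm_of_nonneg (sq_nonneg _)]
    exact le_of_tendsto' hx fun k => (hdefb _ x).2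
  have hone := (integral_eq_zero_iff_of_nonneg (fun x => sq_nonneg _) hint).1 hzero
  refine ⟨w, z, G, fun k => (hadm k).test, hzm, hz0, hGm, hz1, hG1, ?_⟩
  filter_upwards [hae, hone] with x hx hx1
  refine ⟨?_, ?_, ?_⟩
  · have h1 : 1 - ‖η + G x‖ ^ 2 = 0 := by simpa using hx1
    have h2 : ‖η + G x‖ ^ 2 = 1 := by linarith
    exact (pow_eq_one_iff_of_nonneg (norm_nonneg _) two_ne_zero).1 h2
  · refine tendsto_nhds_unique (tendsto_const_nhds.inner hx) ?_
    simp_rw [(hadm _).constraint]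
    exact tendsto_const_nhds
  · set A := flatten (Matrix.vecMulVec a b)
    -- The orthogonal components converge pointwise along the full sequence, with total displacement
    -- at most `δ` from `0`; the subsequence identifies their limit.
    have hpd : ∀ k, dist (perp A (grad (w k) x)) (perp A (grad (w (k + 1)) x)) ≤
        δ / 2 * (1 / 2) ^ k := fun k => by
      rw [dist_comm, dist_eq_norm, ← map_sub, ← hpow]
      exact hperp k x
    obtain ⟨q, hq⟩ := cauchySeq_tendsto_of_complete (cauchySeq_of_le_geometric _ _ hhalf hpd)
    have hqG : q = perp A (G x) := tendsto_nhds_unique (hq.comp hns.tendsto_atTop)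
      (((perp A).continuous.tendsto _).comp hx)
    have h0 : grad (w 0) x = 0 := by rw [grad_eq, hw0]; simp
    have := dist_le_of_le_geometric_of_tendsto₀ _ _ hhalf hpd hq
    rw [h0, map_zero, dist_zero_left, hqG] at this
    exact this.trans_eq (by ring)

end Iteration

end Eikonal

namespace Eikonal

/-! ### Weak gradients: uniqueness and limits of test functions -/

section WeakGradient

variable {m n : ℕ} {Ω : Set (E n)}

lemma IsTestFunction.integrable_mul {ψ : E n → ℝ} (hψ : IsTestFunction Ω ψ) {f : E n → ℝ}
    (hf : LocallyIntegrableOn f Ω) : Integrable (fun x => f x * ψ x) := by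
  obtain ⟨C, -, hC⟩ := hψ.exists_bound
  rw [← integrableOn_iff_integrable_of_support_subset (s := tsupport ψ)
    ((Function.support_mul_subset_right f ψ).trans (subset_tsupport ψ))]
  exact Integrable.mul_bdd (c := C) (hf.integrableOn_compact_subset hψ.2.2 hψ.2.1)
    hψ.1.continuous.aestronglyMeasurable (ae_of_all _ hC)

lemma HasWeakGradient.congr {u u' : E n → E m} {G : E n → Matrix (Fin m) (Fin n) ℝ}
    (h : HasWeakGradient Ω u G) (hu : u =ᵐ[volume.restrict Ω] u') : HasWeakGradient Ω u' G := by
  intro i j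
  obtain ⟨h1, h2, h3⟩ := h i j
  have hui : (fun x => u x i) =ᵐ[volume.restrict Ω] fun x => u' x i := by
    filter_upwards [hu] with x hx
    rw [hx]
  refine ⟨h1.congr hui, h2, fun φ hφ => ?_⟩
  rw [← h3 φ hφ]
  refine integral_congr_ae ?_
  filter_upwards [hui] with x hx
  rw [hx]

lemma HasWeakGradient.add {u u' : E n → E m} {G G' : E n → Matrix (Fin m) (Fin n) ℝ}
    (h : HasWeakGradient Ω u G) (h' : HasWeakGradient Ω u' G') :
    HasWeakGradient Ω (fun x => u x + u' x) (fun x => G x + G' x) := by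
  intro i j
  obtain ⟨h1, h2, h3⟩ := h i j
  obtain ⟨h1', h2', h3'⟩ := h' i j
  refine ⟨h1.add h1', h2.add h2', fun φ hφ => ?_⟩
  have e1 := integral_add ((hφ.partialDeriv j).integrable_mul h1).integrableOn
    (((hφ.partialDeriv j).integrable_mul h1').integrableOn (s := Ω))
  have e2 := integral_add (hφ.integrable_mul h2).integrableOn
    ((hφ.integrable_mul h2').integrableOn (s := Ω))
  simp only [PiLp.add_apply, Matrix.add_apply, add_mul]
  rw [e1, e2, h3 φ hφ, h3' φ hφ, neg_add]

lemma HasWeakGradient.ae_eq (hΩ : IsOpen Ω) {u : E n → E m}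
    {G G' : E n → Matrix (Fin m) (Fin n) ℝ}
    (h : HasWeakGradient Ω u G) (h' : HasWeakGradient Ω u G') :
    ∀ᵐ x ∂(volume.restrict Ω), G x = G' x := by
  have hij : ∀ i j, ∀ᵐ x ∂(volume.restrict Ω), G x i j = G' x i j := by
    intro i j
    obtain ⟨-, h2, h3⟩ := h i j
    obtain ⟨-, h2', h3'⟩ := h' i j
    rw [ae_restrict_iff' hΩ.measurableSet]
    have key := hΩ.ae_eq_zero_of_integral_contDiff_smul_eq_zero (h2.sub h2') fun ψ hψ1 hψ2 hψ3 => by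
      have hψ : IsTestFunction Ω ψ := ⟨hψ1, hψ2, hψ3⟩
      have e0 : ∫ x in Ω, G x i j * ψ x = ∫ x in Ω, G' x i j * ψ x :=
        neg_injective ((h3 ψ hψ).symm.trans (h3' ψ hψ))
      have e1 := hψ.setIntegral_eq fun x => G x i j
      have e2 := hψ.setIntegral_eq fun x => G' x i j
      simp only [smul_eq_mul] at e1 e2
      rw [e1, e2] at e0
      have e3 := integral_sub (hψ.integrable_mul h2) (hψ.integrable_mul h2')
      rw [e0, sub_self] at e3
      rw [← e3]
      congr 1 with x
      simp
      ring
    filter_upwards [key] with x hx hxΩ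
    exact sub_eq_zero.1 (hx hxΩ)
  have := ae_all_iff.2 fun i => ae_all_iff.2 fun j => hij i j
  filter_upwards [this] with x hx
  ext i j
  exact hx i j

lemma affineMap_apply (η : Matrix (Fin m) (Fin n) ℝ) (γ : E m) (x : E n) (i : Fin m) :
    affineMap η γ x i = inner ℝ (WithLp.toLp 2 (η i) : E n) x + γ i := by
  simp [affineMap, Matrix.mulVec, dotProduct, PiLp.inner_apply, mul_comm]

lemma continuous_affineMap (η : Matrix (Fin m) (Fin n) ℝ) (γ : E m) :
    Continuous (affineMap η γ : E n → E m) := by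
  refine (PiLp.continuous_toLp 2 _).comp (continuous_pi fun i => ?_) |>.add continuous_const
  simp only [Matrix.mulVec, dotProduct]
  fun_prop

lemma hasWeakGradient_affineMap (η : Matrix (Fin m) (Fin n) ℝ) (γ : E m) :
    HasWeakGradient Ω (affineMap η γ) (fun _ => η) := by
  intro i j
  have hfun : (fun x : E n => affineMap η γ x i) =
      fun x => innerSL ℝ (WithLp.toLp 2 (η i) : E n) x + γ i := funext fun x =>
    affineMap_apply η γ x i
  have hcd : ContDiff ℝ ∞ fun x : E n => affineMap η γ x i := by
    rw [hfun]
    exact (innerSL ℝ (WithLp.toLp 2 (η i) : E n)).contDiff.add contDiff_const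
  refine ⟨hcd.continuous.locallyIntegrable.locallyIntegrableOn _,
    continuous_const.locallyIntegrable.locallyIntegrableOn _, fun φ hφ => ?_⟩
  rw [integral_mul_partialDeriv hcd hφ]
  congr 2 with x
  congr 1
  have h1 := ((innerSL ℝ (WithLp.toLp 2 (η i) : E n)).hasFDerivAt (x := x)).add_const (γ i)
  rw [hfun, partialDeriv, h1.fderiv, innerSL_apply_apply, EuclideanSpace.inner_single_right]
  simp

lemma tendsto_integral_coord_mul {ι : Type*} [Fintype ι] {f : ℕ → E n → EuclideanSpace ℝ ι}
    {g : E n → EuclideanSpace ℝ ι} (hf : ∀ k, MemLp (f k) 1 (volume.restrict Ω))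
    (hg : MemLp g 1 (volume.restrict Ω))
    (h : Tendsto (fun k => eLpNorm (f k - g) 1 (volume.restrict Ω)) atTop (𝓝 0)) (i : ι)
    {ψ : E n → ℝ} (hψ : IsTestFunction Ω ψ) :
    Tendsto (fun k => ∫ x in Ω, f k x i * ψ x) atTop (𝓝 (∫ x in Ω, g x i * ψ x)) := by
  obtain ⟨C, hC0, hC⟩ := hψ.exists_bound
  have hint : ∀ u : E n → EuclideanSpace ℝ ι, MemLp u 1 (volume.restrict Ω) →
      Integrable (fun x => u x i * ψ x) (volume.restrict Ω) := fun u hu =>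
    ((memLp_one_iff_integrable.1 hu).eval_piLp i).mul_bdd (c := C)
      hψ.1.continuous.aestronglyMeasurable (ae_of_all _ hC)
  refine tendsto_integral_of_L1' _ (hint g hg).1 (Eventually.of_forall fun k => hint _ (hf k)) ?_
  have hb : ∀ k, eLpNorm ((fun x => f k x i * ψ x) - fun x => g x i * ψ x) 1 (volume.restrict Ω) ≤
      ENNReal.ofReal C * eLpNorm (f k - g) 1 (volume.restrict Ω) := fun k => by
    refine eLpNorm_le_mul_eLpNorm_of_ae_le_mul (ae_of_all _ fun x => ?_) 1
    rw [Pi.sub_apply, ← sub_mul, norm_mul, mul_comm]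
    exact mul_le_mul (hC x) (PiLp.norm_apply_le ((f k - g) x) i) (norm_nonneg _) hC0
  refine tendsto_of_tendsto_of_tendsto_of_le_of_le tendsto_const_nhds ?_ (fun _ => zero_le) hb
  have := ENNReal.Tendsto.const_mul h (a := ENNReal.ofReal C) (Or.inr ENNReal.ofReal_ne_top)
  rwa [mul_zero] at this

/-- The matrix with given vector of entries. -/
def unflatten (v : GradSpace m n) : Matrix (Fin m) (Fin n) ℝ := Matrix.of fun i j => v (i, j)

@[simp] lemma flatten_unflatten (v : GradSpace m n) : flatten (unflatten v) = v := rfl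

lemma hasWeakGradient_of_tendsto {φ : ℕ → E n → E m} (hφ : ∀ k, IsTestFunction Ω (φ k))
    {z : E n → E m} {G : E n → GradSpace m n} (hz : MemLp z 1 (volume.restrict Ω))
    (hG : MemLp G 1 (volume.restrict Ω))
    (h1 : Tendsto (fun k => eLpNorm (φ k - z) 1 (volume.restrict Ω)) atTop (𝓝 0))
    (h2 : Tendsto (fun k => eLpNorm (grad (φ k) - G) 1 (volume.restrict Ω)) atTop (𝓝 0)) :
    HasWeakGradient Ω z (fun x => unflatten (G x)) := by
  intro i j
  refine ⟨IntegrableOn.locallyIntegrableOn ((memLp_one_iff_integrable.1 hz).eval_piLp i),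
    IntegrableOn.locallyIntegrableOn ((memLp_one_iff_integrable.1 hG).eval_piLp (i, j)),
    fun ψ hψ => ?_⟩
  have t1 := tendsto_integral_coord_mul (fun k => (hφ k).memLp 1) hz h1 i (hψ.partialDeriv j)
  have t2 := (tendsto_integral_coord_mul (fun k => (hφ k).grad.memLp 1) hG h2 (i, j) hψ).neg
  refine tendsto_nhds_unique t1 (t2.congr fun k => ?_)
  rw [integral_mul_partialDeriv ((hφ k).comp i).1 hψ]
  congr 2 with x
  rw [partialDeriv_comp ((hφ k).differentiable x)]
  rfl

lemma memW1Zero_of_tendsto {φ : ℕ → E n → E m} (hφ : ∀ k, IsTestFunction Ω (φ k))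
    {z : E n → E m} {G : E n → GradSpace m n} (hz : MemLp z 1 (volume.restrict Ω))
    (hG : MemLp G 1 (volume.restrict Ω))
    (h1 : Tendsto (fun k => eLpNorm (φ k - z) 1 (volume.restrict Ω)) atTop (𝓝 0))
    (h2 : Tendsto (fun k => eLpNorm (grad (φ k) - G) 1 (volume.restrict Ω)) atTop (𝓝 0)) :
    MemW1Zero Ω z := by
  have hw := hasWeakGradient_of_tendsto hφ hz hG h1 h2
  refine ⟨⟨hz, _, hw, fun i j => hG.eval_piLp (i, j)⟩, _, hw, φ, hφ, h1, fun i j => ?_⟩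
  refine tendsto_of_tendsto_of_tendsto_of_le_of_le tendsto_const_nhds h2 (fun _ => zero_le)
    fun k => eLpNorm_mono fun x => ?_
  exact PiLp.norm_apply_le ((grad (φ k) - G) x) (i, j)

end WeakGradient

/-! ### Intersections of a line with the unit sphere -/

section Endpoints

variable {m n : ℕ}

/-- The line through a point of the open unit ball meets the unit sphere in two points, which lie
on different sides. -/
lemma exists_norm_add_smul_eq_one_iff {H : Type*} [NormedAddCommGroup H] [InnerProductSpace ℝ H]
    {η A : H} (hη : ‖η‖ < 1) (hA : A ≠ 0) :
    ∃ sp sm : ℝ, sm < 0 ∧ 0 < sp ∧ ∀ s : ℝ, ‖η + s • A‖ = 1 ↔ s = sp ∨ s = sm := by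
  set α := ‖A‖ ^ 2 with hα
  set β := inner ℝ η A with hβ
  set κ := 1 - ‖η‖ ^ 2 with hκ
  have hα0 : 0 < α := by positivity
  have hκ0 : 0 < κ := by nlinarith [norm_nonneg η]
  -- The points solve `α s² + 2 β s - κ = 0`; as `α` and `κ` are positive, `D > |β|` and the roots
  -- have opposite signs.
  set D := Real.sqrt (β ^ 2 + α * κ) with hD
  have hD2 : D ^ 2 = β ^ 2 + α * κ := Real.sq_sqrt (by positivity)
  have hDβ : |β| < D := by
    rw [hD, ← Real.sqrt_sq_eq_abs]
    exact Real.sqrt_lt_sqrt (sq_nonneg _) (by nlinarith)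
  obtain ⟨hl, hr⟩ := abs_lt.1 hDβ
  refine ⟨(-β + D) / α, (-β - D) / α, div_neg_of_neg_of_pos (by linarith) hα0,
    div_pos (by linarith) hα0, fun s => ?_⟩
  have hexp : ‖η + s • A‖ ^ 2 = 1 + (s ^ 2 * α + 2 * s * β - κ) := by
    rw [norm_add_sq_real, inner_smul_right, norm_smul, mul_pow, Real.norm_eq_abs, sq_abs]
    ring
  rw [← pow_eq_one_iff_of_nonneg (norm_nonneg _) two_ne_zero, hexp, eq_div_iff hα0.ne',
    eq_div_iff hα0.ne']
  have hfac : α * (s ^ 2 * α + 2 * s * β - κ) = (s * α - (-β + D)) * (s * α - (-β - D)) := by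
    linear_combination hD2
  rw [add_eq_left, ← sub_eq_zero (a := s * α), ← sub_eq_zero (a := s * α) (b := -β - D),
    ← mul_eq_zero, ← hfac, mul_eq_zero, or_iff_right hα0.ne']

/-- Points of the unit sphere which are close to the line through `η` with direction `A` are close
to the points where this line meets the sphere. -/
lemma exists_infDist_lt {η A : GradSpace m n} {sp sm : ℝ}
    (hs : ∀ s : ℝ, ‖η + s • A‖ = 1 ↔ s = sp ∨ s = sm) {ε : ℝ} (hε : 0 < ε) :
    ∃ δ, 0 < δ ∧ ∀ ξ, ‖η + ξ‖ = 1 → ‖perp A ξ‖ ≤ δ →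
      Metric.infDist (η + ξ) {η + sp • A, η + sm • A} < ε := by
  set S : Set (GradSpace m n) := {η + sp • A, η + sm • A} with hS
  -- On this compact set the distance to the line, `‖perp A (ζ - η)‖`, never vanishes, so it has a
  -- positive minimum; half of it serves as `δ`.
  set K : Set (GradSpace m n) := Metric.sphere 0 1 ∩ {ζ | ε ≤ Metric.infDist ζ S} with hK
  have hKc : IsCompact K := (isCompact_sphere _ _).inter_right
    (isClosed_le continuous_const (Metric.continuous_infDist_pt S))
  rcases K.eq_empty_or_nonempty with hKe | hKne
  · refine ⟨1, one_pos, fun ξ hξ _ => ?_⟩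
    by_contra! hcon
    have : η + ξ ∈ K := ⟨by simpa using hξ, hcon⟩
    rw [hKe] at this
    exact this
  · obtain ⟨ζ, hζ, hmin⟩ := hKc.exists_isMinOn hKne
      (f := fun ζ => ‖perp A (ζ - η)‖) (by fun_prop)
    have hpos : 0 < ‖perp A (ζ - η)‖ := by
      rw [norm_pos_iff]
      intro h0
      obtain ⟨c, hc⟩ := perp_eq_zero h0
      have hζc : ζ = η + c • A := by rw [← hc]; abel
      have h1 : ‖η + c • A‖ = 1 := by rw [← hζc]; simpa using hζ.1
      have hmem : ζ ∈ S := by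
        rw [hζc]
        rcases (hs c).1 h1 with rfl | rfl <;> simp [hS]
      have h2 : ε ≤ Metric.infDist ζ S := hζ.2
      rw [Metric.infDist_zero_of_mem hmem] at h2
      linarith
    refine ⟨‖perp A (ζ - η)‖ / 2, by positivity, fun ξ hξ hp => ?_⟩
    by_contra! hcon
    have h3 : ‖perp A (ζ - η)‖ ≤ ‖perp A (η + ξ - η)‖ :=
      hmin (show η + ξ ∈ K from ⟨by simpa using hξ, hcon⟩)
    rw [add_sub_cancel_left] at h3
    linarith

end Endpoints

/-! ### Existence of solutions and their infinitude -/

section Main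

variable {m n : ℕ}

lemma IsSolution.mono {Ω : Set (E n)} {L : Matrix (Fin m) (Fin n) ℝ} {t : ℝ}
    {η : Matrix (Fin m) (Fin n) ℝ} {γ : E m} {ηp ηm : Matrix (Fin m) (Fin n) ℝ} {ε ε' : ℝ}
    {u : E n → E m} (h : IsSolution Ω L t η γ ηp ηm ε u) (hε : ε ≤ ε') :
    IsSolution Ω L t η γ ηp ηm ε' u := by
  obtain ⟨h1, ⟨G, hG, hGx⟩, h3, h4⟩ := h
  refine ⟨h1, ⟨G, hG, ?_⟩, h3, h4.trans_le (ENNReal.ofReal_le_ofReal hε)⟩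
  filter_upwards [hGx] with x hx
  exact ⟨hx.1, hx.2.1, hx.2.2.trans_le hε⟩

/-- Otherwise uniqueness of weak gradients would give `∇u = η` a.e., against `|∇u| = 1 > |η|`. -/
lemma IsSolution.eLpNorm_sub_ne_zero {Ω : Set (E n)} (hΩ : IsOpen Ω) (hne : Ω.Nonempty)
    {L : Matrix (Fin m) (Fin n) ℝ} {t : ℝ}
    {η : Matrix (Fin m) (Fin n) ℝ} (hη : ‖η‖ < 1) {γ : E m} {ηp ηm : Matrix (Fin m) (Fin n) ℝ}
    {ε : ℝ} {u : E n → E m} (h : IsSolution Ω L t η γ ηp ηm ε u) :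
    eLpNorm (fun x => u x - affineMap η γ x) ∞ (volume.restrict Ω) ≠ 0 := by
  intro h0
  have hmeas : AEStronglyMeasurable (fun x => u x - affineMap η γ x) (volume.restrict Ω) :=
    h.memW1.1.1.sub (continuous_affineMap η γ).aestronglyMeasurable
  rw [eLpNorm_eq_zero_iff hmeas (by simp)] at h0
  obtain ⟨G, hG, hGx⟩ := h.gradient
  have hu : u =ᵐ[volume.restrict Ω] affineMap η γ := by
    filter_upwards [h0] with x hx
    exact sub_eq_zero.1 hx
  have hGη := (hG.congr hu).ae_eq hΩ (hasWeakGradient_affineMap η γ)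
  have : NeZero (volume.restrict Ω) := ⟨by
    rw [Ne, Measure.restrict_eq_zero]
    exact (hΩ.measure_pos volume hne).ne'⟩
  obtain ⟨x, hx1, hx2⟩ := (hGη.and hGx).exists
  rw [hx1] at hx2
  exact hη.ne hx2.1

lemma exists_isSolution {Ω : Set (E n)} (hΩ : IsOpen Ω) (hb : Bornology.IsBounded Ω)
    (L η : Matrix (Fin m) (Fin n) ℝ) (hη : ‖η‖ < 1) (γ : E m)
    (a : Fin m → ℝ) (b : Fin n → ℝ) (ha : a ≠ 0) (hLb : L *ᵥ b ≠ 0)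
    (hLab : matDot L (Matrix.vecMulVec a b) = 0) {sp sm : ℝ}
    (hs : ∀ s : ℝ, ‖η + s • Matrix.vecMulVec a b‖ = 1 ↔ s = sp ∨ s = sm) {ε : ℝ} (hε : 0 < ε) :
    ∃ u : Lp (E m) ∞ (volume.restrict Ω), IsSolution Ω L (matDot L η) η γ
      (η + sp • Matrix.vecMulVec a b) (η + sm • Matrix.vecMulVec a b) ε u := by
  set A := Matrix.vecMulVec a b with hA
  set μ := volume.restrict Ω with hμ
  have hfin : volume Ω ≠ ⊤ := hb.measure_lt_top.ne
  have hfin' : IsFiniteMeasure μ := ⟨by simpa [hμ] using hfin.lt_top⟩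
  have hs' : ∀ s : ℝ, ‖flatten η + s • flatten A‖ = 1 ↔ s = sp ∨ s = sm := fun s => by
    rw [← flatten_smul, ← flatten_add, norm_flatten, hs]
  obtain ⟨δ₁, hδ₁, hclose⟩ := exists_infDist_lt hs' hε
  -- The bound `δ₁` forces the gradient near the two endpoints; `ε / 2` makes the sup-norm bound
  -- strict.
  obtain ⟨w, z, G, hw, hzm, hzb, hGm, hwz, hwG, hGx⟩ := exists_limit L a b ha hLb hLab hΩ hfin
    (flatten η) (by rwa [norm_flatten]) (lt_min hδ₁ (half_pos hε))
  have hzL : MemLp z ∞ μ := memLp_top_of_bound hzm _ (ae_of_all _ hzb)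
  have hGL : MemLp G ∞ μ := by
    refine memLp_top_of_bound hGm 2 ?_
    filter_upwards [hGx] with x hx
    calc ‖G x‖ = ‖(flatten η + G x) - flatten η‖ := by congr 1; abel
      _ ≤ 2 := (norm_sub_le _ _).trans (by rw [hx.1, norm_flatten]; linarith)
  have haff : MemLp (affineMap η γ : E n → E m) ∞ μ := by
    obtain ⟨C, hC⟩ := (hb.isCompact_closure.image (continuous_affineMap η γ)).isBounded
      |>.exists_norm_le
    refine memLp_top_of_bound (continuous_affineMap η γ).aestronglyMeasurable C ?_
    filter_upwards [ae_restrict_mem hΩ.measurableSet] with x hx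
    exact hC _ (Set.mem_image_of_mem _ (subset_closure hx))
  have hwk := hasWeakGradient_of_tendsto hw (hzL.mono_exponent le_top)
    (hGL.mono_exponent le_top) hwz hwG
  set u : Lp (E m) ∞ μ := (hzL.add haff).toLp with hu
  have hu_ae : (fun x => z x + affineMap η γ x) =ᵐ[μ] u := (hzL.add haff).coeFn_toLp.symm
  have hz_ae : z =ᵐ[μ] fun x => u x - affineMap η γ x := by
    filter_upwards [hu_ae] with x hx
    rw [← hx, add_sub_cancel_right]
  have hwk' := hwk.congr hz_ae
  have huG : HasWeakGradient Ω u (fun x => unflatten (G x) + η) :=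
    (hwk.add (hasWeakGradient_affineMap η γ)).congr hu_ae
  have hz'L := hzL.ae_eq hz_ae
  refine ⟨u, ⟨Lp.memLp u, _, huG, fun i j => (hGL.eval_piLp (i, j)).add (memLp_const _)⟩,
    ⟨_, huG, ?_⟩, ⟨⟨hz'L, _, hwk', fun i j => hGL.eval_piLp (i, j)⟩, ?_⟩, ?_⟩
  · filter_upwards [hGx] with x hx
    have hfl : flatten (unflatten (G x) + η) = flatten η + G x := by
      rw [flatten_add, flatten_unflatten, add_comm]
    refine ⟨?_, ?_, ?_⟩
    · rw [← norm_flatten, hfl, hx.1]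
    · rw [matDot_eq_inner, hfl, inner_add_right, hx.2.1, add_zero, ← matDot_eq_inner]
    · have h1 := hclose (G x) hx.1 (hx.2.2.trans (min_le_left _ _))
      have hiso : Isometry (flatten : Matrix (Fin m) (Fin n) ℝ → GradSpace m n) :=
        Isometry.of_dist_eq dist_flatten
      rw [← Metric.infDist_image hiso, Set.image_pair, hfl]
      exact h1
  · refine memW1Zero_of_tendsto hw (hz'L.mono_exponent le_top) (hGL.mono_exponent le_top)
      (hwz.congr fun k => eLpNorm_congr_ae ?_) hwG
    filter_upwards [hz_ae] with x hx
    rw [Pi.sub_apply, Pi.sub_apply, hx]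
  · rw [← eLpNorm_congr_ae hz_ae, eLpNorm_exponent_top]
    refine (eLpNormEssSup_le_of_ae_bound (ae_of_all _ hzb)).trans_lt ?_
    exact (ENNReal.ofReal_lt_ofReal_iff hε).2 ((min_le_right _ _).trans_lt (half_lt_self hε))

end Main

end Eikonal

/-- Elements of `Lp` are classes of maps modulo equality a.e. in `Ω`, so that solutions are
counted as elements of `W^{1,∞}(Ω; ℝ^m)`. -/
theorem theorem1p4 {m n : ℕ} (hm : 2 ≤ m) (hn : 2 ≤ n)
    (Ω : Set (Eikonal.E n)) (hΩ : Eikonal.IsBoundedLipschitzDomain Ω)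
    (L η : Matrix (Fin m) (Fin n) ℝ) (hη : ‖η‖ < 1) (γ : Eikonal.E m)
    (a : Fin m → ℝ) (b : Fin n → ℝ) (ha : a ≠ 0) (hLb : L *ᵥ b ≠ 0)
    (hLab : Eikonal.matDot L (Matrix.vecMulVec a b) = 0) :
    ∃ sp sm : ℝ, sm < 0 ∧ 0 < sp ∧
      (∀ s : ℝ, ‖η + s • Matrix.vecMulVec a b‖ = 1 ↔ s = sp ∨ s = sm) ∧
      ∀ ε : ℝ, 0 < ε →
        Set.Infinite {u : Lp (Eikonal.E m) ∞ (volume.restrict Ω) |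
          Eikonal.IsSolution Ω L (Eikonal.matDot L η) η γ
            (η + sp • Matrix.vecMulVec a b) (η + sm • Matrix.vecMulVec a b) ε u} := by
  have hb : b ≠ 0 := by rintro rfl; simp at hLb
  obtain ⟨sp, sm, hsm, hsp, hs'⟩ := Eikonal.exists_norm_add_smul_eq_one_iff
    (η := Eikonal.flatten η) (by rwa [Eikonal.norm_flatten]) (Eikonal.flatten_vecMulVec_ne_zero ha hb)
  have hs : ∀ s : ℝ, ‖η + s • Matrix.vecMulVec a b‖ = 1 ↔ s = sp ∨ s = sm := fun s => by
    rw [← hs', ← Eikonal.flatten_smul, ← Eikonal.flatten_add, Eikonal.norm_flatten]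
  refine ⟨sp, sm, hsm, hsp, hs, fun ε hε hfinite => ?_⟩
  have hex : ∀ ε : ℝ, 0 < ε → _ := fun ε hε =>
    Eikonal.exists_isSolution hΩ.isOpen hΩ.isBounded L η hη γ a b ha hLb hLab hs hε
  -- If there were finitely many solutions, one would be closest to the affine map. Its distance is
  -- positive, so using that distance as the new `ε` yields a strictly closer solution, a
  -- contradiction.
  obtain ⟨u₀, hu₀, hmin⟩ := Set.exists_min_image _ (fun u : Lp (Eikonal.E m) ∞ (volume.restrict Ω) =>
    eLpNorm (fun x => u x - Eikonal.affineMap η γ x) ∞ (volume.restrict Ω)) hfinite (hex ε hε)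
  have h0 := hu₀.eLpNorm_sub_ne_zero hΩ.isOpen hΩ.isConnected.nonempty hη
  have htop := (hu₀.close.trans ENNReal.ofReal_lt_top).ne
  obtain ⟨u, hu⟩ := hex _ (ENNReal.toReal_pos h0 htop)
  have hlt := hu.close
  rw [ENNReal.ofReal_toReal htop] at hlt
  exact (hmin u (hu.mono (ENNReal.toReal_le_of_le_ofReal hε.le hu₀.close.le))).not_gt hlt
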